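/- Let $d\ge 1$, $s\in(0,1)$ and $\lambda,\Lambda>0$. For $R\ge 0$ put $B_R=\{x\in\mathbb R^d:|x|<R\}$, $I_R=(-R^{2s},0]$, $Q_R=B_R\times I_R$ (so $Q_0=\emptyset$), and $d((x,t),(y,\tau))=\max\{|x-y|,|t-\tau|^{1/(2s)}\}$. For $\rho\ge 0$ let $\mathcal K_\rho$ be the set of measurable $K:\mathbb R^d\to[0,\infty)$ with $K(y)\ge\lambda\min\{|y|^{-d-2s},\rho^{-d-2s}\}$ for all $y\ne 0$ (where $\rho^{-d-2s}=\infty$ if $\rho=0$), $\int_{B_{2r}\setminus B_r}K(y)\,dy\le\Lambda r^{-2s}$ for all $r>0$ and, if $s=1/2$, also $\int_{B_{2r}\setminus B_r}yK(y)\,dy=0$ for all $r>0$. Put $L_Kw(x)=\int_{\mathbb R^d}\delta_yw(x)K(y)\,dy$, where $\delta_yw(x)$ is $w(x+y)-w(x)$ if $s<1/2$, $w(x+y)-w(x)-y\cdot\nabla w(x)\mathbf 1_{B_1}(y)$ if $s=1/2$, and $w(x+y)-w(x)-y\cdot\nabla w(x)$ if $s>1/2$. Let $\mathcal M_\rho^+w(x)=\sup_{K\in\mathcal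 K_\rho}L_Kw(x)$ and $\mathcal M_\rho^-w(x)=\inf_{K\in\mathcal K_\rho}L_Kw(x)$. A bounded measurable function $u$ on $\mathbb R^d\times I$ (with measurable time slices), upper semicontinuous in $\Omega\times I$, solves $\partial_tu-F(u)\le f$ in $\Omega\times I$ in the viscosity sense if the following holds for all $(x_0,t_0)\in\Omega\times I$ and $\varepsilon>0$ with $Z:=B_\varepsilon(x_0)\times(t_0-\varepsilon,t_0]\subseteq\Omega\times I$: whenever $\varphi:Z\to\mathbb R$ is left-differentiable in time and $C^{1,1}$ in space, $u(x_0,t_0)=\varphi(x_0,t_0)$ and $u\le\varphi$ in $Z$, the function $v$ that equals $\varphi$ in $Z$ and $u$ elsewhere satisfies $\partial_tv(x_0,t_0)-F(v(\cdot,t_0))(x_0)\le f(x_0,t_0)$, where $\partial_t$ is the left derivative. The inequality $\partial_tu-F(u)\ge f$ is defined in the same way, with lower semicontinuous $u$, with $u\ge\varphi$ in $Z$, and with $\ge$ in the conclusion. Write $\|u\|_\infty=\sup_{\mathbb R^d\times I_R}|u|$. **Theorem.** (a) Let $s\ge 1/2$ and $R_0>0$. There are $\alpha\in(0,2s)$ and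 $C>0$, depending only on $d,s,\lambda,\Lambda,R_0$, such that the following holds for all $\rho\ge 0$ with $\mathcal K_\rho\neq\emptyset$, all $R\in(\rho,R_0]$, all $A\ge 0$ and all bounded measurable $u$ on $\mathbb R^d\times I_R$ (with measurable time slices): if $$\partial_tu-\Lambda|\nabla u|-\mathcal M_\rho^+u\le A\quad\text{and}\quad\partial_tu+\Lambda|\nabla u|-\mathcal M_\rho^-u\ge-A\quad\text{in }Q_R$$ in the viscosity sense, then $$R^\alpha\,\frac{|u(x,t)-u(0,0)|}{d((x,t),(0,0))^\alpha}\le C\left(\|u\|_\infty+R^{2s}A\right)\qquad\text{for all }(x,t)\in Q_R\setminus Q_\rho,\ (x,t)\ne(0,0).$$ (b) For every $s\in(0,1)$ there are $\alpha\in(0,2s)$ and $C>0$, depending only on $d,s,\lambda,\Lambda$, such that the same estimate holds for all $\rho\ge 0$ with $\mathcal K_\rho\ne\emptyset$, all $R>\rho$, all $A\ge 0$ and all bounded measurable $u$ on $\mathbb R^d\times I_R$ (with measurable time slices) that satisfy, in the viscosity sense, $$\partial_tu-\mathcal M_\rho^+u\le A\quad\text{and}\quad\partial_tu-\mathcal M_\rho^-u\ge-A\quad\text{in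 }Q_R.$$ -/

import Mathlib

noncomputable section

namespace NonlocalParabolic

open MeasureTheory Set

/-- The Euclidean space `ℝᵈ`. -/
abbrev Rd (d : ℕ) : Type := EuclideanSpace ℝ (Fin d)

/-! ### Parabolic geometry -/

/-- The time interval `I_R = (-R^{2s}, 0]`. -/
def timeInterval (s R : ℝ) : Set ℝ := Ioc (-(R ^ (2 * s))) 0

/-- The parabolic cylinder `Q_R = B_R × I_R`; it is empty for `R = 0`. -/
def cylinder (d : ℕ) (s R : ℝ) : Set (Rd d × ℝ) :=
  Metric.ball (0 : Rd d) R ×ˢ timeInterval s R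

/-- The parabolic distance `max {|x - y|, |t - τ|^{1/(2s)}}`. -/
def parabolicDist {d : ℕ} (s : ℝ) (p q : Rd d × ℝ) : ℝ :=
  max ‖p.1 - q.1‖ (|p.2 - q.2| ^ (1 / (2 * s)))

/-! ### Kernels, linear operators and extremal operators -/

/-- `min {|y|^{-d-2s}, ρ^{-d-2s}}`, with the convention `ρ^{-d-2s} = ∞` if `ρ = 0`. -/
def truncatedKernel {d : ℕ} (s ρ : ℝ) (y : Rd d) : ℝ :=
  if ρ = 0 then ‖y‖ ^ (-(d : ℝ) - 2 * s)
  else min (‖y‖ ^ (-(d : ℝ) - 2 * s)) (ρ ^ (-(d : ℝ) - 2 * s))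

/-- The annulus `B_{2r} ∖ B_r`. -/
def annulus (d : ℕ) (r : ℝ) : Set (Rd d) := Metric.ball 0 (2 * r) \ Metric.ball 0 r

/-- Membership in the class `𝒦_ρ` of admissible kernels `K : ℝᵈ → [0, ∞)`. The upper bound is
stated for the (always meaningful) integral with values in `[0, ∞]`; in particular it
contains the integrability of `K` on annuli. -/
structure IsAdmissibleKernel {d : ℕ} (s lam Lam ρ : ℝ) (K : Rd d → ℝ) : Prop where
  aemeasurable : AEMeasurable K volume
  nonneg : ∀ y, 0 ≤ K y
  lower : ∀ y, y ≠ 0 → lam * truncatedKernel s ρ y ≤ K y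
  upper : ∀ r : ℝ, 0 < r →
    ∫⁻ y in annulus d r, ENNReal.ofReal (K y) ≤ ENNReal.ofReal (Lam * r ^ (-(2 * s)))
  cancellation : s = 1 / 2 → ∀ r : ℝ, 0 < r → ∫ y in annulus d r, K y • y = 0

/-- The class `𝒦_ρ`. -/
def kernelClass (d : ℕ) (s lam Lam ρ : ℝ) : Set (Rd d → ℝ) :=
  {K | IsAdmissibleKernel s lam Lam ρ K}

/-- The difference operator `δ_y w(x)`. -/
def diffOp {d : ℕ} (s : ℝ) (y : Rd d) (w : Rd d → ℝ) (x : Rd d) : ℝ :=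
  if s < 1 / 2 then w (x + y) - w x
  else if s = 1 / 2 then
    w (x + y) - w x - (Metric.ball (0 : Rd d) 1).indicator (fun z => inner ℝ z (gradient w x)) y
  else w (x + y) - w x - inner ℝ y (gradient w x)

/-- The integro-differential operator `L_K w(x) = ∫ δ_y w(x) K(y) dy`. -/
def linearOp {d : ℕ} (s : ℝ) (K : Rd d → ℝ) (w : Rd d → ℝ) (x : Rd d) : ℝ :=
  ∫ y, diffOp s y w x * K y

/-- The extremal operator `ℳ_ρ⁺ w(x) = sup_{K ∈ 𝒦_ρ} L_K w(x)`. -/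
def pucciSup {d : ℕ} (s lam Lam ρ : ℝ) (w : Rd d → ℝ) (x : Rd d) : ℝ :=
  sSup ((fun K => linearOp s K w x) '' kernelClass d s lam Lam ρ)

/-- The extremal operator `ℳ_ρ⁻ w(x) = inf_{K ∈ 𝒦_ρ} L_K w(x)`. -/
def pucciInf {d : ℕ} (s lam Lam ρ : ℝ) (w : Rd d → ℝ) (x : Rd d) : ℝ :=
  sInf ((fun K => linearOp s K w x) '' kernelClass d s lam Lam ρ)

/-! ### Bounded functions and viscosity solutions -/

/-- `u` is bounded and (Lebesgue) measurable on `ℝᵈ × I`. Since viscosity inequalities are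
evaluated at single times, `u` is a function with well-defined values, and measurability
is also required of each time slice. Values of `u` at times outside `I` are irrelevant. -/
structure IsBoundedOn {d : ℕ} (I : Set ℝ) (u : Rd d → ℝ → ℝ) : Prop where
  bounded : ∃ M : ℝ, ∀ x, ∀ t ∈ I, |u x t| ≤ M
  aemeasurable : AEMeasurable (Function.uncurry u) (volume.restrict (univ ×ˢ I))
  aemeasurable_slice : ∀ t ∈ I, AEMeasurable (fun x => u x t) volume

/-- The supremum norm of `u` over `ℝᵈ × I`. -/
def supNorm {d : ℕ} (I : Set ℝ) (u : Rd d → ℝ → ℝ) : ℝ :=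
  sSup {a : ℝ | ∃ x, ∃ t ∈ I, a = |u x t|}

/-- The backward cylinder `B_ε(x₀) × (t₀ - ε, t₀]`. -/
def backwardCylinder {d : ℕ} (x₀ : Rd d) (t₀ ε : ℝ) : Set (Rd d × ℝ) :=
  Metric.ball x₀ ε ×ˢ Ioc (t₀ - ε) t₀

/-- The left derivative in time. -/
def leftDeriv (g : ℝ → ℝ) (t : ℝ) : ℝ := derivWithin g (Iic t) t

/-- `φ` is a test function on `B_ε(x₀) × (t₀ - ε, t₀]`: left-differentiable in time and
`C^{1,1}` in space. -/
structure IsTestFunction {d : ℕ} (x₀ : Rd d) (t₀ ε : ℝ) (φ : Rd d → ℝ → ℝ) : Prop where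
  time : ∀ x ∈ Metric.ball x₀ ε, ∀ t ∈ Ioc (t₀ - ε) t₀, DifferentiableWithinAt ℝ (φ x) (Iic t) t
  space : ∀ t ∈ Ioc (t₀ - ε) t₀,
    DifferentiableOn ℝ (fun x => φ x t) (Metric.ball x₀ ε) ∧
    ∃ L : NNReal, LipschitzOnWith L (gradient fun x => φ x t) (Metric.ball x₀ ε)

open Classical in
/-- The function equal to `φ` in `B_ε(x₀) × (t₀ - ε, t₀]` and to `u` elsewhere. -/
def glue {d : ℕ} (x₀ : Rd d) (t₀ ε : ℝ) (φ u : Rd d → ℝ → ℝ) : Rd d → ℝ → ℝ :=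
  fun x t => if (x, t) ∈ backwardCylinder x₀ t₀ ε then φ x t else u x t

/-- `u` solves `∂ₜ u - F(u) ≤ f` in `Ω × I` in the viscosity sense, for an operator `F` acting on
functions of the space variable. -/
structure IsViscositySubsolution {d : ℕ} (F : (Rd d → ℝ) → Rd d → ℝ) (f : Rd d → ℝ → ℝ)
    (Ω : Set (Rd d)) (I : Set ℝ) (u : Rd d → ℝ → ℝ) : Prop where
  bounded : IsBoundedOn I u
  semicontinuous : UpperSemicontinuousOn (Function.uncurry u) (Ω ×ˢ I)
  touching : ∀ x₀ ∈ Ω, ∀ t₀ ∈ I, ∀ ε : ℝ, 0 < ε → backwardCylinder x₀ t₀ ε ⊆ Ω ×ˢ I →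
    ∀ φ : Rd d → ℝ → ℝ, IsTestFunction x₀ t₀ ε φ → u x₀ t₀ = φ x₀ t₀ →
    (∀ p ∈ backwardCylinder x₀ t₀ ε, u p.1 p.2 ≤ φ p.1 p.2) →
    leftDeriv (glue x₀ t₀ ε φ u x₀) t₀ - F (fun x => glue x₀ t₀ ε φ u x t₀) x₀ ≤ f x₀ t₀

/-- `u` solves `∂ₜ u - F(u) ≥ f` in `Ω × I` in the viscosity sense. -/
structure IsViscositySupersolution {d : ℕ} (F : (Rd d → ℝ) → Rd d → ℝ) (f : Rd d → ℝ → ℝ)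
    (Ω : Set (Rd d)) (I : Set ℝ) (u : Rd d → ℝ → ℝ) : Prop where
  bounded : IsBoundedOn I u
  semicontinuous : LowerSemicontinuousOn (Function.uncurry u) (Ω ×ˢ I)
  touching : ∀ x₀ ∈ Ω, ∀ t₀ ∈ I, ∀ ε : ℝ, 0 < ε → backwardCylinder x₀ t₀ ε ⊆ Ω ×ˢ I →
    ∀ φ : Rd d → ℝ → ℝ, IsTestFunction x₀ t₀ ε φ → u x₀ t₀ = φ x₀ t₀ →
    (∀ p ∈ backwardCylinder x₀ t₀ ε, φ p.1 p.2 ≤ u p.1 p.2) →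
    f x₀ t₀ ≤ leftDeriv (glue x₀ t₀ ε φ u x₀) t₀ - F (fun x => glue x₀ t₀ ε φ u x t₀) x₀

/-- The pair of extremal inequalities with drift bound `b`,
`∂ₜ u - b|∇u| - ℳ_ρ⁺ u ≤ A` and `∂ₜ u + b|∇u| - ℳ_ρ⁻ u ≥ -A` in `Q_R`, in the viscosity sense. -/
def SolvesExtremalInequalities {d : ℕ} (s lam Lam ρ b A R : ℝ) (u : Rd d → ℝ → ℝ) : Prop :=
  IsViscositySubsolution (fun w x => b * ‖gradient w x‖ + pucciSup s lam Lam ρ w x)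
    (fun _ _ => A) (Metric.ball 0 R) (timeInterval s R) u ∧
  IsViscositySupersolution (fun w x => -(b * ‖gradient w x‖) + pucciInf s lam Lam ρ w x)
    (fun _ _ => -A) (Metric.ball 0 R) (timeInterval s R) u

/-- The partial Hölder estimate at the origin, at all points of `Q_R ∖ Q_ρ`. -/
def PartialHolderAtZero {d : ℕ} (s ρ R A α C : ℝ) (u : Rd d → ℝ → ℝ) : Prop :=
  ∀ x : Rd d, ∀ t : ℝ, (x, t) ∈ cylinder d s R \ cylinder d s ρ →
    R ^ α * (|u x t - u 0 0| / parabolicDist s (x, t) (0, 0) ^ α) ≤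
      C * (supNorm (timeInterval s R) u + R ^ (2 * s) * A)

end NonlocalParabolic

end

open NonlocalParabolic

noncomputable section

namespace NonlocalParabolic

open MeasureTheory Set

/-! ### Integrals of admissible kernels -/

/-! The oscillation of `u` decays by a fixed factor each time the parabolic scale shrinks by 4, as
long as the scale stays above `ρ`. The lower bound on the kernels is all that drives the decay, and
truncation at `ρ` does not affect that bound when `ρ ≤ 2 * r`. Iterating down to the scale of the
given point yields the Hölder quotient.

One step rests on `growth_lemma`. Suppose `u ≤ c + a` in the large cylinder and `u ≤ c` on half of a
past cylinder. Compare `u` with `c + a`, up to small increasing corrections, minus `a * m t * bump r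
x`. Here `m` accumulates over time the measure of the sets `{u(·, t) ≤ c}`, damped by an
exponential. At a positive maximum of the difference the equation can be tested. The integral
operator jumps directly into `{u(·, t₀) ≤ c}`, where `u` lies at least `a/2` below the barrier, so
it contributes a negative term proportional to the measure of that set. This pays for the growth of
`m`, and the corrections then give a contradiction. No ABP or covering argument is needed.

The barrier works because of `exists_bump_bound`: the bump is a subsolution up to a multiple of
itself, and the exponential absorbs that multiple. Where the bump is small, long jumps into its core
give a fixed gain. Since its gradient is of order the square root of the bump, Young's inequality
handles all drifts. These include the one produced by moving the gradient correction to radius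
comparable with `r` (`exists_drift_bound`), which treats the three ranges of `s` uniformly.

Because the time density of the sublevel sets has no useful regularity, `exists_time_weight`
replaces it by a smaller upper semicontinuous one. Its primitive admits linear lower bounds to the
left of each time. Applying the growth lemma to `u` and to `-u` gives `oscillation_dichotomy`. A
growth condition outside the cylinder, stable under the step, controls the tails in
`exists_oscillation_step`. -/

theorem measurableSet_annulus (d : ℕ) (r : ℝ) : MeasurableSet (annulus d r) :=
  measurableSet_ball.diff measurableSet_ball

theorem mem_annulus {d : ℕ} {r : ℝ} {y : Rd d} : y ∈ annulus d r ↔ r ≤ ‖y‖ ∧ ‖y‖ < 2 * r := by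
  simp [annulus, and_comm]

/-- On a dyadic annulus the weight is comparable to `r ^ p`, so only the integrated upper bound on
`K` enters. Every moment estimate below is a geometric sum of these. -/
theorem IsAdmissibleKernel.lintegral_annulus_le {d : ℕ} {s lam Lam ρ : ℝ} {K : Rd d → ℝ}
    (hK : IsAdmissibleKernel s lam Lam ρ K) {p r : ℝ} (hp : 0 ≤ p) (hr : 0 < r) :
    ∫⁻ y in annulus d r, ENNReal.ofReal (‖y‖ ^ p * K y) ≤
      ENNReal.ofReal (2 ^ p * Lam * r ^ (p - 2 * s)) := by
  calc ∫⁻ y in annulus d r, ENNReal.ofReal (‖y‖ ^ p * K y)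
      ≤ ∫⁻ y in annulus d r, ENNReal.ofReal ((2 * r) ^ p) * ENNReal.ofReal (K y) := by
        refine setLIntegral_mono' (measurableSet_annulus d r) fun y hy => ?_
        rw [← ENNReal.ofReal_mul (by positivity)]
        refine ENNReal.ofReal_le_ofReal (mul_le_mul_of_nonneg_right ?_ (hK.nonneg y))
        exact Real.rpow_le_rpow (norm_nonneg y) (mem_annulus.1 hy).2.le hp
    _ = ENNReal.ofReal ((2 * r) ^ p) * ∫⁻ y in annulus d r, ENNReal.ofReal (K y) :=
        lintegral_const_mul' _ _ ENNReal.ofReal_ne_top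
    _ ≤ ENNReal.ofReal ((2 * r) ^ p) * ENNReal.ofReal (Lam * r ^ (-(2 * s))) := by
        gcongr; exact hK.upper r hr
    _ = ENNReal.ofReal (2 ^ p * Lam * r ^ (p - 2 * s)) := by
        rw [← ENNReal.ofReal_mul (by positivity), Real.mul_rpow (by norm_num) hr.le,
          sub_eq_add_neg, Real.rpow_add hr]
        ring_nf

theorem tsum_ofReal_geometric {C q : ℝ} (hC : 0 ≤ C) (hq : 0 ≤ q) (hq1 : q < 1) :
    ∑' i : ℕ, ENNReal.ofReal (C * q ^ i) = ENNReal.ofReal (C / (1 - q)) := by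
  rw [← ENNReal.ofReal_tsum_of_nonneg (fun i => by positivity)
    ((summable_geometric_of_lt_one hq hq1).mul_left C), tsum_mul_left,
    tsum_geometric_of_lt_one hq hq1, div_eq_mul_inv]

theorem two_rpow_lt_one {p : ℝ} (hp : p < 0) : (2 : ℝ) ^ p < 1 :=
  Real.rpow_lt_one_of_one_lt_of_neg (by norm_num) hp

/-- The moments of order `p > 2s` of an admissible kernel over a ball. -/
theorem IsAdmissibleKernel.lintegral_ball_le {d : ℕ} {s lam Lam ρ : ℝ} {K : Rd d → ℝ}
    (hK : IsAdmissibleKernel s lam Lam ρ K) (hLam : 0 < Lam) {p a : ℝ} (hp0 : 0 < p)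
    (hp : 2 * s < p) (ha : 0 < a) :
    ∫⁻ y in Metric.ball 0 a, ENNReal.ofReal (‖y‖ ^ p * K y) ≤
      ENNReal.ofReal (2 ^ p * Lam / (1 - 2 ^ (2 * s - p)) * a ^ (p - 2 * s)) := by
  have hq := two_rpow_lt_one (show 2 * s - p < 0 by linarith)
  -- The outermost annulus has inner radius `a / 2`, hence the index `i + 1`. The origin lies in no
  -- annulus; it is kept apart and contributes nothing because `p > 0` makes the weight vanish
  -- there.
  have hcover : Metric.ball (0 : Rd d) a ⊆ {0} ∪ ⋃ i : ℕ, annulus d (a * 2⁻¹ ^ (i + 1)) := by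
    intro y hy
    rw [mem_ball_zero_iff] at hy
    by_cases h0 : y = 0
    · simp [h0]
    · right
      have hy0 : 0 < ‖y‖ := norm_pos_iff.2 h0
      obtain ⟨n, hn1, hn2⟩ := exists_mem_Ico_zpow (div_pos hy0 ha) (one_lt_two (α := ℝ))
      have hn : n < 0 := by
        by_contra! h
        have := one_le_zpow₀ (one_le_two (α := ℝ)) h
        rw [le_div_iff₀ ha] at hn1
        nlinarith
      obtain ⟨m, hm⟩ := Int.exists_eq_neg_ofNat hn.le
      obtain ⟨i, rfl⟩ : ∃ i, m = i + 1 := ⟨m - 1, by omega⟩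
      rw [mem_iUnion]
      refine ⟨i, mem_annulus.2 ?_⟩
      rw [le_div_iff₀ ha] at hn1
      rw [div_lt_iff₀ ha, zpow_add₀ (by norm_num)] at hn2
      rw [hm, zpow_neg, zpow_natCast, ← inv_pow] at hn1 hn2
      constructor
      · linarith
      · rw [zpow_one] at hn2; linarith
  calc ∫⁻ y in Metric.ball 0 a, ENNReal.ofReal (‖y‖ ^ p * K y)
      ≤ ∫⁻ y in {0} ∪ ⋃ i : ℕ, annulus d (a * 2⁻¹ ^ (i + 1)), ENNReal.ofReal (‖y‖ ^ p * K y) :=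
        lintegral_mono_set hcover
    _ ≤ (∫⁻ y in ({0} : Set (Rd d)), ENNReal.ofReal (‖y‖ ^ p * K y)) +
        ∫⁻ y in ⋃ i : ℕ, annulus d (a * 2⁻¹ ^ (i + 1)), ENNReal.ofReal (‖y‖ ^ p * K y) :=
        lintegral_union_le _ _ _
    _ = ∫⁻ y in ⋃ i : ℕ, annulus d (a * 2⁻¹ ^ (i + 1)), ENNReal.ofReal (‖y‖ ^ p * K y) := by
        rw [setLIntegral_congr_fun (g := fun _ => 0) (measurableSet_singleton 0), lintegral_zero,
          zero_add]
        rintro y rfl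
        simp [Real.zero_rpow hp0.ne']
    _ ≤ ∑' i : ℕ, ∫⁻ y in annulus d (a * 2⁻¹ ^ (i + 1)), ENNReal.ofReal (‖y‖ ^ p * K y) :=
        lintegral_iUnion_le _ _
    _ ≤ ∑' i : ℕ, ENNReal.ofReal
          (2 ^ p * Lam * a ^ (p - 2 * s) * (2 ^ (2 * s - p)) ^ i) := by
        refine ENNReal.tsum_le_tsum fun i => (hK.lintegral_annulus_le hp0.le (by positivity)).trans
          (ENNReal.ofReal_le_ofReal ?_)
        have key : ((2 : ℝ)⁻¹ ^ (i + 1)) ^ (p - 2 * s) = (2 ^ (2 * s - p)) ^ (i + 1) := by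
          rw [← Real.rpow_natCast, ← Real.rpow_natCast, Real.inv_rpow (by norm_num),
            ← Real.rpow_neg (by norm_num), ← Real.rpow_mul (by norm_num),
            ← Real.rpow_mul (by norm_num)]
          ring_nf
        rw [Real.mul_rpow ha.le (by positivity), ← mul_assoc, key, pow_succ]
        exact mul_le_mul_of_nonneg_left (mul_le_of_le_one_right (by positivity) hq.le)
          (by positivity)
    _ = _ := by
        rw [tsum_ofReal_geometric (by positivity) (by positivity) hq]
        ring_nf

/-- The moments of order `0 ≤ p < 2s` of an admissible kernel over the complement of a ball. -/
theorem IsAdmissibleKernel.lintegral_compl_ball_le {d : ℕ} {s lam Lam ρ : ℝ} {K : Rd d → ℝ}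
    (hK : IsAdmissibleKernel s lam Lam ρ K) (hLam : 0 < Lam) {p a : ℝ} (hp0 : 0 ≤ p)
    (hp : p < 2 * s) (ha : 0 < a) :
    ∫⁻ y in (Metric.ball 0 a)ᶜ, ENNReal.ofReal (‖y‖ ^ p * K y) ≤
      ENNReal.ofReal (2 ^ p * Lam / (1 - 2 ^ (p - 2 * s)) * a ^ (p - 2 * s)) := by
  have hq := two_rpow_lt_one (show p - 2 * s < 0 by linarith)
  have hcover : (Metric.ball (0 : Rd d) a)ᶜ ⊆ ⋃ i : ℕ, annulus d (a * 2 ^ i) := by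
    intro y hy
    rw [mem_compl_iff, mem_ball_zero_iff, not_lt] at hy
    obtain ⟨n, hn1, hn2⟩ := exists_nat_pow_near ((one_le_div ha).2 hy) (one_lt_two (α := ℝ))
    rw [mem_iUnion]
    refine ⟨n, mem_annulus.2 ?_⟩
    rw [le_div_iff₀ ha] at hn1
    rw [div_lt_iff₀ ha, pow_succ] at hn2
    constructor <;> linarith
  calc ∫⁻ y in (Metric.ball 0 a)ᶜ, ENNReal.ofReal (‖y‖ ^ p * K y)
      ≤ ∫⁻ y in ⋃ i : ℕ, annulus d (a * 2 ^ i), ENNReal.ofReal (‖y‖ ^ p * K y) :=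
        lintegral_mono_set hcover
    _ ≤ ∑' i : ℕ, ∫⁻ y in annulus d (a * 2 ^ i), ENNReal.ofReal (‖y‖ ^ p * K y) :=
        lintegral_iUnion_le _ _
    _ ≤ ∑' i : ℕ, ENNReal.ofReal
          (2 ^ p * Lam * a ^ (p - 2 * s) * (2 ^ (p - 2 * s)) ^ i) := by
        refine ENNReal.tsum_le_tsum fun i => (hK.lintegral_annulus_le hp0 (by positivity)).trans
          (ENNReal.ofReal_le_ofReal (le_of_eq ?_))
        rw [Real.mul_rpow ha.le (by positivity), ← mul_assoc, ← Real.rpow_natCast,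
          ← Real.rpow_mul (by norm_num), ← Real.rpow_natCast, ← Real.rpow_mul (by norm_num),
          mul_comm (i : ℝ)]
    _ = _ := by
        rw [tsum_ofReal_geometric (by positivity) (by positivity) hq]
        ring_nf

theorem integrableOn_and_integral_le_of_lintegral_le {d : ℕ} {S : Set (Rd d)}
    {f : Rd d → ℝ} (hf : AEMeasurable f volume) (hf0 : ∀ y, 0 ≤ f y) {C : ℝ} (hC : 0 ≤ C)
    (h : ∫⁻ y in S, ENNReal.ofReal (f y) ≤ ENNReal.ofReal C) :
    IntegrableOn f S ∧ ∫ y in S, f y ≤ C := by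
  have hm : AEStronglyMeasurable f (volume.restrict S) := hf.restrict.aestronglyMeasurable
  constructor
  · refine ⟨hm, ?_⟩
    rw [hasFiniteIntegral_iff_ofReal (Filter.Eventually.of_forall hf0)]
    exact h.trans_lt ENNReal.ofReal_lt_top
  · rw [integral_eq_lintegral_of_nonneg_ae (Filter.Eventually.of_forall hf0) hm]
    exact ENNReal.toReal_le_of_le_ofReal hC h

theorem IsAdmissibleKernel.aemeasurable_norm_rpow_mul {d : ℕ} {s lam Lam ρ : ℝ} {K : Rd d → ℝ}
    (hK : IsAdmissibleKernel s lam Lam ρ K) (p : ℝ) :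
    AEMeasurable (fun y => ‖y‖ ^ p * K y) volume :=
  ((measurable_norm.pow_const p).aemeasurable).mul hK.aemeasurable

theorem IsAdmissibleKernel.moment_ball {d : ℕ} {s lam Lam ρ : ℝ} {K : Rd d → ℝ}
    (hK : IsAdmissibleKernel s lam Lam ρ K) (hLam : 0 < Lam) {p a : ℝ} (hp0 : 0 < p)
    (hp : 2 * s < p) (ha : 0 < a) :
    IntegrableOn (fun y => ‖y‖ ^ p * K y) (Metric.ball 0 a) ∧
    ∫ y in Metric.ball 0 a, ‖y‖ ^ p * K y ≤
      2 ^ p * Lam / (1 - 2 ^ (2 * s - p)) * a ^ (p - 2 * s) := by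
  have hq := two_rpow_lt_one (show 2 * s - p < 0 by linarith)
  have : 0 < 1 - (2 : ℝ) ^ (2 * s - p) := by linarith
  exact integrableOn_and_integral_le_of_lintegral_le (hK.aemeasurable_norm_rpow_mul p)
    (fun y => mul_nonneg (by positivity) (hK.nonneg y)) (by positivity)
    (hK.lintegral_ball_le hLam hp0 hp ha)

theorem IsAdmissibleKernel.moment_compl_ball {d : ℕ} {s lam Lam ρ : ℝ} {K : Rd d → ℝ}
    (hK : IsAdmissibleKernel s lam Lam ρ K) (hLam : 0 < Lam) {p a : ℝ} (hp0 : 0 ≤ p)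
    (hp : p < 2 * s) (ha : 0 < a) :
    IntegrableOn (fun y => ‖y‖ ^ p * K y) (Metric.ball 0 a)ᶜ ∧
    ∫ y in (Metric.ball 0 a)ᶜ, ‖y‖ ^ p * K y ≤
      2 ^ p * Lam / (1 - 2 ^ (p - 2 * s)) * a ^ (p - 2 * s) := by
  have hq := two_rpow_lt_one (show p - 2 * s < 0 by linarith)
  have : 0 < 1 - (2 : ℝ) ^ (p - 2 * s) := by linarith
  exact integrableOn_and_integral_le_of_lintegral_le (hK.aemeasurable_norm_rpow_mul p)
    (fun y => mul_nonneg (by positivity) (hK.nonneg y)) (by positivity)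
    (hK.lintegral_compl_ball_le hLam hp0 hp ha)

theorem IsAdmissibleKernel.integrableOn_compl_ball {d : ℕ} {s lam Lam ρ : ℝ} {K : Rd d → ℝ}
    (hK : IsAdmissibleKernel s lam Lam ρ K) (hLam : 0 < Lam) (hs : 0 < s) {a : ℝ} (ha : 0 < a) :
    IntegrableOn K (Metric.ball 0 a)ᶜ := by
  simpa using (hK.moment_compl_ball hLam le_rfl (by linarith) ha).1

theorem IsAdmissibleKernel.integral_compl_ball_le {d : ℕ} {s lam Lam ρ : ℝ} {K : Rd d → ℝ}
    (hK : IsAdmissibleKernel s lam Lam ρ K) (hLam : 0 < Lam) (hs : 0 < s) {a : ℝ} (ha : 0 < a) :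
    ∫ y in (Metric.ball 0 a)ᶜ, K y ≤ Lam / (1 - 2 ^ (-(2 * s))) * a ^ (-(2 * s)) := by
  simpa using (hK.moment_compl_ball hLam le_rfl (by linarith) ha).2

theorem IsAdmissibleKernel.moment_annulus {d : ℕ} {s lam Lam ρ : ℝ} {K : Rd d → ℝ}
    (hK : IsAdmissibleKernel s lam Lam ρ K) (hLam : 0 < Lam) {r : ℝ} (hr : 0 < r) :
    IntegrableOn (fun y => ‖y‖ * K y) (annulus d r) ∧
    ∫ y in annulus d r, ‖y‖ * K y ≤ 2 * Lam * r ^ (1 - 2 * s) := by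
  have h := hK.lintegral_annulus_le zero_le_one hr
  simp only [Real.rpow_one] at h
  exact integrableOn_and_integral_le_of_lintegral_le
    (measurable_norm.aemeasurable.mul hK.aemeasurable)
    (fun y => mul_nonneg (by positivity) (hK.nonneg y)) (by positivity) h

theorem IsAdmissibleKernel.integrableOn_smul_annulus {d : ℕ} {s lam Lam ρ : ℝ} {K : Rd d → ℝ}
    (hK : IsAdmissibleKernel s lam Lam ρ K) (hLam : 0 < Lam) {r : ℝ} (hr : 0 < r) :
    IntegrableOn (fun y => K y • y) (annulus d r) := by
  refine Integrable.mono (hK.moment_annulus hLam hr).1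
    (hK.aemeasurable.restrict.smul aemeasurable_id).aestronglyMeasurable
    (Filter.Eventually.of_forall fun y => ?_)
  rw [norm_smul, Real.norm_of_nonneg (hK.nonneg y), mul_comm,
    Real.norm_of_nonneg (mul_nonneg (norm_nonneg y) (hK.nonneg y))]

/-! ### Changing the radius of the gradient correction -/

/-- Cancellation holds only on annuli of ratio exactly 2. Peeling `n` of them off from the inside
leaves a remainder within a single annulus, whose first moment is at most `2 * Lam`. The bound
therefore does not see the ratio `b / a`, as scale invariance at `s = 1/2` demands. -/
theorem IsAdmissibleKernel.integral_shell_le {d : ℕ} {lam Lam ρ : ℝ} {K : Rd d → ℝ}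
    (hK : IsAdmissibleKernel (1 / 2) lam Lam ρ K) (hLam : 0 < Lam) (n : ℕ) {a b : ℝ} (ha : 0 < a)
    (h1 : 2 ^ n * a ≤ b) (h2 : b < 2 ^ (n + 1) * a) :
    IntegrableOn (fun y => K y • y) (Metric.ball 0 b \ Metric.ball 0 a) ∧
      ‖∫ y in Metric.ball 0 b \ Metric.ball 0 a, K y • y‖ ≤ 2 * Lam := by
  induction n generalizing a with
  | zero =>
    have hsub : Metric.ball (0 : Rd d) b \ Metric.ball 0 a ⊆ annulus d a :=
      sdiff_subset_sdiff_left (Metric.ball_subset_ball (by simpa using h2.le))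
    have hmom := hK.moment_annulus hLam ha
    have hint := (hK.integrableOn_smul_annulus hLam ha).mono_set hsub
    refine ⟨hint, ?_⟩
    calc ‖∫ y in Metric.ball 0 b \ Metric.ball 0 a, K y • y‖
        ≤ ∫ y in Metric.ball 0 b \ Metric.ball 0 a, ‖K y • y‖ := norm_integral_le_integral_norm _
      _ = ∫ y in Metric.ball 0 b \ Metric.ball 0 a, ‖y‖ * K y := by
          congr with y
          rw [norm_smul, Real.norm_of_nonneg (hK.nonneg y), mul_comm]
      _ ≤ ∫ y in annulus d a, ‖y‖ * K y :=
          setIntegral_mono_set hmom.1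
            (Filter.Eventually.of_forall fun y => mul_nonneg (norm_nonneg y) (hK.nonneg y))
            hsub.eventuallyLE
      _ ≤ 2 * Lam := by simpa using hmom.2
  | succ n ih =>
    have hdec : Metric.ball (0 : Rd d) b \ Metric.ball 0 a =
        annulus d a ∪ (Metric.ball 0 b \ Metric.ball 0 (2 * a)) := by
      have h3 : 2 * a ≤ b := by
        have : (1 : ℝ) ≤ 2 ^ n := one_le_pow₀ (by norm_num)
        rw [pow_succ] at h1
        nlinarith
      ext y
      simp only [annulus, mem_sdiff, mem_ball_zero_iff, mem_union, not_lt]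
      constructor
      · rintro ⟨h, h'⟩
        by_cases hy : ‖y‖ < 2 * a
        · exact Or.inl ⟨hy, h'⟩
        · exact Or.inr ⟨h, not_lt.1 hy⟩
      · rintro (⟨h, h'⟩ | ⟨h, h'⟩)
        · exact ⟨h.trans_le h3, h'⟩
        · exact ⟨h, by linarith⟩
    obtain ⟨i1, i2⟩ := ih (a := 2 * a) (by positivity) (by rw [pow_succ] at h1; linarith)
      (by rw [pow_succ] at h2; linarith)
    have hA := hK.integrableOn_smul_annulus hLam ha
    rw [hdec]
    refine ⟨hA.union i1, ?_⟩
    rw [setIntegral_union _ (measurableSet_ball.diff measurableSet_ball) hA i1,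
      hK.cancellation rfl a ha, zero_add]
    · exact i2
    · rw [Set.disjoint_left]
      rintro y hy hy'
      exact hy'.2 hy.1

theorem IsAdmissibleKernel.integral_diff_ball_le {d : ℕ} {lam Lam ρ : ℝ} {K : Rd d → ℝ}
    (hK : IsAdmissibleKernel (1 / 2) lam Lam ρ K) (hLam : 0 < Lam) {a b : ℝ} (ha : 0 < a)
    (hab : a ≤ b) (g : Rd d) :
    Integrable (fun y => ((Metric.ball (0 : Rd d) b).indicator (fun z => inner ℝ z g) y -
        (Metric.ball (0 : Rd d) a).indicator (fun z => inner ℝ z g) y) * K y) ∧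
      |∫ y, ((Metric.ball (0 : Rd d) b).indicator (fun z => inner ℝ z g) y -
        (Metric.ball (0 : Rd d) a).indicator (fun z => inner ℝ z g) y) * K y| ≤
        2 * Lam * ‖g‖ := by
  obtain ⟨n, hn1, hn2⟩ := exists_nat_pow_near ((one_le_div ha).2 hab) (one_lt_two (α := ℝ))
  rw [le_div_iff₀ ha] at hn1
  rw [div_lt_iff₀ ha] at hn2
  obtain ⟨i1, i2⟩ := hK.integral_shell_le hLam n ha hn1 hn2
  have hm : MeasurableSet (Metric.ball (0 : Rd d) b \ Metric.ball 0 a) :=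
    measurableSet_ball.diff measurableSet_ball
  have heq : (fun y => ((Metric.ball (0 : Rd d) b).indicator (fun z => inner ℝ z g) y -
        (Metric.ball (0 : Rd d) a).indicator (fun z => inner ℝ z g) y) * K y) =
      (Metric.ball (0 : Rd d) b \ Metric.ball 0 a).indicator fun y => inner ℝ g (K y • y) := by
    ext y
    have hsub := Metric.ball_subset_ball (x := (0 : Rd d)) hab
    by_cases hya : y ∈ Metric.ball (0 : Rd d) a
    · simp [hya, hsub hya]
    · by_cases hyb : y ∈ Metric.ball (0 : Rd d) b
      · rw [indicator_of_mem hyb, indicator_of_notMem hya, indicator_of_mem (mem_sdiff y |>.2 ⟨hyb, hya⟩),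
          inner_smul_right, real_inner_comm]
        ring
      · simp [hya, hyb]
  rw [heq, integrable_indicator_iff hm, integral_indicator hm]
  refine ⟨i1.const_inner g, ?_⟩
  rw [integral_inner i1 g]
  calc |inner ℝ g (∫ y in Metric.ball 0 b \ Metric.ball 0 a, K y • y)|
      ≤ ‖g‖ * ‖∫ y in Metric.ball 0 b \ Metric.ball 0 a, K y • y‖ := abs_real_inner_le_norm _ _
    _ ≤ ‖g‖ * (2 * Lam) := by gcongr
    _ = 2 * Lam * ‖g‖ := by ring

/-- Away from `s = 1/2` no cancellation is needed: the first moment is finite over a ball when `s <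
1/2` and over its complement when `s > 1/2`. -/
theorem integrable_indicator_inner_mul {d : ℕ} {K : Rd d → ℝ} (hK : AEMeasurable K volume)
    (hK0 : ∀ y, 0 ≤ K y) {S : Set (Rd d)} (hS : MeasurableSet S) {C : ℝ}
    (h : IntegrableOn (fun y => ‖y‖ * K y) S) (hC : ∫ y in S, ‖y‖ * K y ≤ C) (g : Rd d) :
    Integrable (fun y => S.indicator (fun z => inner ℝ z g) y * K y) ∧
      |∫ y, S.indicator (fun z => inner ℝ z g) y * K y| ≤ C * ‖g‖ := by
  have heq : (fun y => S.indicator (fun z => inner ℝ z g) y * K y) =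
      S.indicator fun y => inner ℝ y g * K y := by
    ext y
    by_cases hy : y ∈ S <;> simp [hy]
  have hbd : ∀ y, ‖inner ℝ y g * K y‖ ≤ ‖g‖ * (‖y‖ * K y) := fun y => by
    rw [norm_mul, Real.norm_of_nonneg (hK0 y), Real.norm_eq_abs, ← mul_assoc, mul_comm ‖g‖]
    exact mul_le_mul_of_nonneg_right (abs_real_inner_le_norm y g) (hK0 y)
  rw [heq, integrable_indicator_iff hS, integral_indicator hS]
  refine ⟨Integrable.mono' (h.const_mul ‖g‖) ?_ (Filter.Eventually.of_forall hbd), ?_⟩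
  · exact (((measurable_id.inner measurable_const).aemeasurable).mul
      hK).restrict.aestronglyMeasurable
  · calc |∫ y in S, inner ℝ y g * K y| ≤ ∫ y in S, ‖g‖ * (‖y‖ * K y) :=
        norm_integral_le_of_norm_le (h.const_mul ‖g‖) (Filter.Eventually.of_forall hbd)
      _ = ‖g‖ * ∫ y in S, ‖y‖ * K y := integral_const_mul _ _
      _ ≤ ‖g‖ * C := by gcongr
      _ = C * ‖g‖ := mul_comm _ _

/-- The difference quotient with the gradient correction restricted to the ball of radius `a`. -/
def localDiff {d : ℕ} (a : ℝ) (w : Rd d → ℝ) (x y : Rd d) : ℝ :=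
  w (x + y) - w x - (Metric.ball (0 : Rd d) a).indicator (fun z => inner ℝ z (gradient w x)) y

/-- Replacing the gradient correction in `δ_y w(x)` by the one in the ball of radius `a` changes
`L_K w(x)` by a drift term of size `a^{1-2s}`. -/
theorem exists_drift_bound {s Lam : ℝ} (hs1 : s < 1) (hLam : 0 < Lam) :
    ∃ D : ℝ, 0 ≤ D ∧ ∀ (d : ℕ) (lam ρ : ℝ) (K : Rd d → ℝ), IsAdmissibleKernel s lam Lam ρ K →
      ∀ (a : ℝ), 0 < a → ∀ (w : Rd d → ℝ) (x : Rd d),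
        Integrable (fun y => (diffOp s y w x - localDiff a w x y) * K y) ∧
        |∫ y, (diffOp s y w x - localDiff a w x y) * K y| ≤
          D * a ^ (1 - 2 * s) * ‖gradient w x‖ := by
  rcases lt_trichotomy s (1 / 2) with h | h | h
  · have hq := two_rpow_lt_one (show 2 * s - 1 < 0 by linarith)
    refine ⟨2 ^ (1 : ℝ) * Lam / (1 - 2 ^ (2 * s - 1)),
      div_nonneg (by positivity) (by linarith), fun d lam ρ K hK a ha w x => ?_⟩
    have hm := hK.moment_ball hLam one_pos (by linarith) ha
    simp only [Real.rpow_one] at hm ⊢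
    have := integrable_indicator_inner_mul hK.aemeasurable hK.nonneg measurableSet_ball
      hm.1 hm.2 (gradient w x)
    simpa only [diffOp, localDiff, if_pos h, sub_sub_cancel] using this
  · subst h
    refine ⟨2 * Lam, by positivity, fun d lam ρ K hK a ha w x => ?_⟩
    simp only [diffOp, localDiff, lt_irrefl, if_false, if_true, sub_sub_sub_cancel_left]
    have h0 : (1 : ℝ) - 2 * (1 / 2) = 0 := by norm_num
    rw [h0, Real.rpow_zero, mul_one]
    rcases le_total a 1 with h1 | h1
    · have := hK.integral_diff_ball_le hLam ha h1 (gradient w x)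
      rw [← integrable_neg_iff, ← abs_neg, ← integral_neg]
      simpa only [Pi.neg_def, ← neg_mul, neg_sub] using this
    · exact hK.integral_diff_ball_le hLam one_pos h1 (gradient w x)
  · have hq := two_rpow_lt_one (show 1 - 2 * s < 0 by linarith)
    refine ⟨2 ^ (1 : ℝ) * Lam / (1 - 2 ^ (1 - 2 * s)),
      div_nonneg (by positivity) (by linarith), fun d lam ρ K hK a ha w x => ?_⟩
    have hm := hK.moment_compl_ball hLam zero_le_one (by linarith) ha
    simp only [Real.rpow_one] at hm ⊢
    have := integrable_indicator_inner_mul hK.aemeasurable hK.nonneg measurableSet_ball.compl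
      hm.1 hm.2 (gradient w x)
    have heq : (fun y => (diffOp s y w x - localDiff a w x y) * K y) =
        -fun y => (Metric.ball (0 : Rd d) a)ᶜ.indicator
          (fun z => inner ℝ z (gradient w x)) y * K y := by
      ext y
      simp only [diffOp, localDiff, if_neg h.not_gt, if_neg h.ne', indicator_compl, Pi.sub_apply,
        Pi.neg_apply]
      ring
    rw [heq, integrable_neg_iff, integral_neg', abs_neg]
    exact this

/-! ### The bump function -/

/-- The positive part of `1 - |x|²/r²`. -/
def cap {d : ℕ} (r : ℝ) (x : Rd d) : ℝ := max 0 (1 - ‖x‖ ^ 2 / r ^ 2)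

/-- The `C^{1,1}` bump function `((1 - |x|²/r²)₊)²`. -/
def bump {d : ℕ} (r : ℝ) (x : Rd d) : ℝ := cap r x ^ 2

/-- The gradient of `bump r`. -/
def bumpGrad {d : ℕ} (r : ℝ) (x : Rd d) : Rd d := (-(4 * cap r x / r ^ 2)) • x

variable {d : ℕ}

theorem cap_nonneg (r : ℝ) (x : Rd d) : 0 ≤ cap r x := le_max_left _ _

theorem cap_le_one (r : ℝ) (x : Rd d) : cap r x ≤ 1 :=
  max_le zero_le_one (by have : 0 ≤ ‖x‖ ^ 2 / r ^ 2 := by positivity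
                         linarith)

theorem continuous_cap (r : ℝ) : Continuous (cap r : Rd d → ℝ) := by
  unfold cap; fun_prop

theorem continuous_bump (r : ℝ) : Continuous (bump r : Rd d → ℝ) := (continuous_cap r).pow 2

theorem bump_nonneg (r : ℝ) (x : Rd d) : 0 ≤ bump r x := sq_nonneg _

theorem bump_le_one (r : ℝ) (x : Rd d) : bump r x ≤ 1 :=
  pow_le_one₀ (cap_nonneg r x) (cap_le_one r x)

theorem cap_eq_zero {r : ℝ} (hr : 0 < r) {x : Rd d} (hx : r ≤ ‖x‖) : cap r x = 0 := by
  refine max_eq_left ?_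
  rw [sub_nonpos, one_le_div (by positivity)]
  exact pow_le_pow_left₀ hr.le hx 2

theorem bump_eq_zero {r : ℝ} (hr : 0 < r) {x : Rd d} (hx : r ≤ ‖x‖) : bump r x = 0 := by
  simp [bump, cap_eq_zero hr hx]

theorem le_bump {r : ℝ} (hr : 0 < r) {x : Rd d} (hx : ‖x‖ ≤ r / 2) : 9 / 16 ≤ bump r x := by
  have h : ‖x‖ ^ 2 / r ^ 2 ≤ 1 / 4 := by
    rw [div_le_iff₀ (by positivity)]
    nlinarith [norm_nonneg x]
  have : 3 / 4 ≤ cap r x := le_max_of_le_right (by linarith)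
  unfold bump
  nlinarith

theorem cap_mul_norm_le {r : ℝ} (hr : 0 < r) (x : Rd d) : cap r x * ‖x‖ ≤ cap r x * r := by
  rcases le_total r ‖x‖ with h | h
  · simp [cap_eq_zero hr h]
  · exact mul_le_mul_of_nonneg_left h (cap_nonneg r x)

/-- Squaring the cap makes the gradient of order the square root of the bump. This is what later
lets first order terms be absorbed. -/
theorem norm_bumpGrad_le {r : ℝ} (hr : 0 < r) (x : Rd d) : r * ‖bumpGrad r x‖ ≤ 4 * cap r x := by
  have h := cap_mul_norm_le hr x
  have h0 := cap_nonneg r x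
  rw [bumpGrad, norm_smul, norm_neg, Real.norm_of_nonneg (by positivity)]
  rw [show r * (4 * cap r x / r ^ 2 * ‖x‖) = 4 * (cap r x * ‖x‖) / r by field_simp,
    div_le_iff₀ hr]
  linarith

theorem cap_le_of_norm_le {r : ℝ} (hr : 0 < r) {x : Rd d} (hx : r ≤ ‖x‖) (y : Rd d) :
    cap r (x + y) ≤ 2 * (‖y‖ / r) := by
  refine max_le (by positivity) ?_
  have h1 : ‖x‖ ≤ ‖x + y‖ + ‖y‖ := by
    simpa using norm_sub_le (x + y) y
  have h2 : 1 - ‖y‖ / r ≤ ‖x + y‖ / r := by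
    rw [← sub_nonneg, show ‖x + y‖ / r - (1 - ‖y‖ / r) = (‖x + y‖ + ‖y‖ - r) / r by field_simp; ring]
    exact div_nonneg (by linarith) hr.le
  have h3 : 0 ≤ ‖x + y‖ / r := by positivity
  rw [← div_pow]
  nlinarith [sq_nonneg (‖x + y‖ / r - 1)]

/-- For `|x| ≥ r` the bump and its gradient vanish at `x`, and the cap at `x + y` is at most
`2|y|/r`. For `|x| ≤ r` everything reduces to the scaled quantities `X` and `Y` with `|X| ≤ Y`. If
`Y ≤ 1` and the cap is not truncated, the error is at most `(2X + Y²)² ≤ 9Y²`, which is the origin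
of the constant 9. -/
theorem abs_bump_sub_le {r : ℝ} (hr : 0 < r) (x y : Rd d) :
    |bump r (x + y) - bump r x - inner ℝ y (bumpGrad r x)| ≤ 9 / r ^ 2 * ‖y‖ ^ 2 := by
  have hY : 9 / r ^ 2 * ‖y‖ ^ 2 = 9 * (‖y‖ / r) ^ 2 := by field_simp
  rw [hY]
  set Y := ‖y‖ / r with hYdef
  have hY0 : 0 ≤ Y := by positivity
  rcases le_total r ‖x‖ with hx | hx
  · have h1 := cap_le_of_norm_le hr hx y
    have h2 := cap_nonneg r (x + y)
    simp only [bump, bumpGrad, cap_eq_zero hr hx]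
    simp only [ne_eq, OfNat.ofNat_ne_zero, not_false_eq_true, zero_pow, sub_zero, mul_zero,
      zero_div, neg_zero, zero_smul, inner_zero_right, abs_of_nonneg (sq_nonneg (cap r (x + y)))]
    nlinarith
  · set X := inner ℝ y x / r ^ 2 with hX
    have hXY : |X| ≤ Y := by
      rw [hX, abs_div, abs_of_pos (show 0 < r ^ 2 by positivity), div_le_iff₀ (by positivity),
        hYdef, show ‖y‖ / r * r ^ 2 = ‖y‖ * r by field_simp]
      exact (abs_real_inner_le_norm y x).trans (by gcongr)
    have hin : inner ℝ y (bumpGrad r x) = -4 * cap r x * X := by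
      rw [bumpGrad, inner_smul_right, hX]; ring
    have hcx : cap r x = 1 - ‖x‖ ^ 2 / r ^ 2 := by
      refine max_eq_right ?_
      rw [sub_nonneg, div_le_one (by positivity)]
      exact pow_le_pow_left₀ (norm_nonneg x) hx 2
    have hw : 1 - ‖x + y‖ ^ 2 / r ^ 2 = cap r x - 2 * X - Y ^ 2 := by
      rw [hcx, hX, hYdef, norm_add_sq_real, real_inner_comm]
      field_simp
      ring
    have hcxy : cap r (x + y) = max 0 (cap r x - 2 * X - Y ^ 2) := by rw [← hw]; rfl
    have h1 := cap_le_one r (x + y)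
    have h2 := cap_nonneg r (x + y)
    have h3 := cap_le_one r x
    have h4 := cap_nonneg r x
    rw [hin]
    simp only [bump]
    have hX1 := abs_le.1 hXY
    have hge : cap r x - 2 * X - Y ^ 2 ≤ cap r (x + y) := hcxy ▸ le_max_right _ _
    generalize cap r (x + y) = W at *
    generalize cap r x = z at *
    clear_value X Y
    rw [abs_le]
    constructor
    · nlinarith [sq_nonneg (W - z)]
    · rcases le_total Y 1 with hY1 | hY1
      · have hX2 : X ^ 2 ≤ Y ^ 2 := by nlinarith
        rcases le_total 0 (z - 2 * X - Y ^ 2) with h | h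
        · rw [max_eq_right h] at hcxy
          rw [hcxy]
          nlinarith [mul_nonneg hY0 hY0, mul_nonneg (mul_nonneg hY0 hY0) hY0,
            sq_nonneg (2 * X + Y ^ 2), mul_le_mul hY1 hY1 hY0 zero_le_one]
        · rw [max_eq_left h] at hcxy
          rw [hcxy]
          nlinarith
      · nlinarith

/-- The quadratic Taylor estimate holds globally, so differentiability is read off from it without
differentiating the positive part. -/
theorem hasGradientAt_bump {r : ℝ} (hr : 0 < r) (x : Rd d) :
    HasGradientAt (bump r) (bumpGrad r x) x := by
  rw [hasGradientAt_iff_hasFDerivAt, hasFDerivAt_iff_isLittleO_nhds_zero]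
  have hO : (fun h : Rd d => bump r (x + h) - bump r x -
      (InnerProductSpace.toDual ℝ (Rd d)) (bumpGrad r x) h) =O[nhds 0]
      fun h => ‖h‖ ^ 2 := by
    refine Asymptotics.IsBigO.of_bound (9 / r ^ 2) (Filter.Eventually.of_forall fun h => ?_)
    rw [InnerProductSpace.toDual_apply_apply, real_inner_comm, Real.norm_eq_abs, norm_pow, norm_norm]
    exact abs_bump_sub_le hr x h
  exact hO.trans_isLittleO (Asymptotics.isLittleO_norm_pow_id one_lt_two)

theorem gradient_bump {r : ℝ} (hr : 0 < r) : gradient (bump r : Rd d → ℝ) = bumpGrad r :=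
  funext fun x => (hasGradientAt_bump hr x).gradient

theorem lipschitzOnWith_bumpGrad {r : ℝ} (hr : 0 < r) (x₀ : Rd d) (ε : ℝ) :
    ∃ L : NNReal, LipschitzOnWith L (bumpGrad r : Rd d → Rd d) (Metric.ball x₀ ε) := by
  set N : ℝ := ‖x₀‖ + |ε| with hN
  have hN0 : 0 ≤ N := by positivity
  refine ⟨(4 / r ^ 2 * (1 + 2 * N ^ 2 / r ^ 2)).toNNReal, LipschitzOnWith.of_dist_le_mul ?_⟩
  have hb : ∀ x ∈ Metric.ball x₀ ε, ‖x‖ ≤ N := fun x hx => by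
    have h1 : ‖x‖ ≤ ‖x₀‖ + ‖x - x₀‖ := by simpa using norm_add_le x₀ (x - x₀)
    rw [mem_ball_iff_norm] at hx
    linarith [le_abs_self ε]
  intro x hx y hy
  have hcap : |cap r x - cap r y| ≤ 2 * N / r ^ 2 * ‖x - y‖ := by
    calc |cap r x - cap r y| ≤ |(1 - ‖x‖ ^ 2 / r ^ 2) - (1 - ‖y‖ ^ 2 / r ^ 2)| := by
          unfold cap
          rw [max_comm 0, max_comm 0]
          exact abs_max_sub_max_le_abs _ _ _
      _ = |‖x‖ - ‖y‖| * (‖x‖ + ‖y‖) / r ^ 2 := by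
          rw [← abs_of_nonneg (show 0 ≤ ‖x‖ + ‖y‖ by positivity), ← abs_mul,
            ← abs_of_nonneg (show 0 ≤ r ^ 2 by positivity), ← abs_div, ← abs_neg]
          simp only [abs_of_nonneg (show 0 ≤ r ^ 2 by positivity)]
          congr 1
          ring
      _ ≤ ‖x - y‖ * (N + N) / r ^ 2 := by
          gcongr
          · exact abs_norm_sub_norm_le x y
          · exact hb x hx
          · exact hb y hy
      _ = 2 * N / r ^ 2 * ‖x - y‖ := by ring
  rw [dist_eq_norm, dist_eq_norm, Real.coe_toNNReal _ (by positivity)]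
  have hdec : bumpGrad r x - bumpGrad r y =
      (-(4 / r ^ 2)) • (cap r x • (x - y) + (cap r x - cap r y) • y) := by
    simp only [bumpGrad]
    module
  rw [hdec, norm_smul, norm_neg, Real.norm_of_nonneg (by positivity), mul_assoc]
  gcongr
  calc ‖cap r x • (x - y) + (cap r x - cap r y) • y‖
      ≤ cap r x * ‖x - y‖ + |cap r x - cap r y| * ‖y‖ := by
        refine (norm_add_le _ _).trans ?_
        rw [norm_smul, norm_smul, Real.norm_of_nonneg (cap_nonneg r x), Real.norm_eq_abs]
    _ ≤ 1 * ‖x - y‖ + (2 * N / r ^ 2 * ‖x - y‖) * N := by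
        gcongr
        · exact cap_le_one r x
        · exact hb y hy
    _ = (1 + 2 * N ^ 2 / r ^ 2) * ‖x - y‖ := by ring

/-! ### The bump function as a barrier -/

theorem localDiff_bump_abs_le {r : ℝ} (hr : 0 < r) {a : ℝ} (x y : Rd d)
    (hy : y ∈ Metric.ball (0 : Rd d) a) :
    |localDiff a (bump r) x y| ≤ 9 / r ^ 2 * ‖y‖ ^ 2 := by
  rw [localDiff, indicator_of_mem hy, gradient_bump hr]
  exact abs_bump_sub_le hr x y

theorem localDiff_of_notMem {w : Rd d → ℝ} {a : ℝ} (x : Rd d) {y : Rd d}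
    (hy : y ∉ Metric.ball (0 : Rd d) a) : localDiff a w x y = w (x + y) - w x := by
  rw [localDiff, indicator_of_notMem hy, sub_zero]

theorem measurable_localDiff {w : Rd d → ℝ} (hw : Measurable w) (a : ℝ) (x : Rd d) :
    Measurable (localDiff a w x) := by
  unfold localDiff
  refine ((hw.comp (measurable_const_add x)).sub_const _).sub ?_
  exact (measurable_id.inner measurable_const).indicator measurableSet_ball

theorem IsAdmissibleKernel.integrable_localDiff_bump {s lam Lam ρ : ℝ} {K : Rd d → ℝ}
    (hK : IsAdmissibleKernel s lam Lam ρ K) (hs : 0 < s) (hs1 : s < 1) (hLam : 0 < Lam) {r a : ℝ}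
    (hr : 0 < r) (ha : 0 < a) (x : Rd d) :
    Integrable (fun y => localDiff a (bump r) x y * K y) := by
  have hmeas : AEStronglyMeasurable (fun y => localDiff a (bump r) x y * K y) volume :=
    ((measurable_localDiff (continuous_bump r).measurable a x).aemeasurable.mul
      hK.aemeasurable).aestronglyMeasurable
  rw [← integrableOn_univ, ← union_compl_self (Metric.ball (0 : Rd d) a)]
  refine IntegrableOn.union ?_ ?_
  · refine Integrable.mono' ((hK.moment_ball hLam two_pos (by linarith) ha).1.const_mul (9 / r ^ 2))
      hmeas.restrict ((ae_restrict_mem measurableSet_ball).mono fun y hy => ?_)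
    rw [norm_mul, Real.norm_of_nonneg (hK.nonneg y), Real.norm_eq_abs, ← mul_assoc]
    refine mul_le_mul_of_nonneg_right ?_ (hK.nonneg y)
    simpa using localDiff_bump_abs_le hr x y hy
  · refine Integrable.mono' (hK.integrableOn_compl_ball hLam hs ha) hmeas.restrict
      ((ae_restrict_mem measurableSet_ball.compl).mono fun y hy => ?_)
    rw [norm_mul, Real.norm_of_nonneg (hK.nonneg y), Real.norm_eq_abs]
    refine mul_le_of_le_one_left (hK.nonneg y) ?_
    rw [localDiff_of_notMem x hy, abs_le]
    constructor <;>
    linarith [bump_nonneg r x, bump_le_one r x, bump_nonneg r (x + y), bump_le_one r (x + y)]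

/-- Split at `|y| = a`: inside, the second order Taylor estimate applies; outside, the gradient
correction is absent and the two terms of the difference can be integrated separately. -/
theorem IsAdmissibleKernel.le_integral_localDiff_bump {s lam Lam ρ : ℝ} {K : Rd d → ℝ}
    (hK : IsAdmissibleKernel s lam Lam ρ K) (hs : 0 < s) (hs1 : s < 1) (hLam : 0 < Lam) {r a : ℝ}
    (hr : 0 < r) (ha : 0 < a) (x : Rd d) :
    (∫ y in (Metric.ball 0 a)ᶜ, bump r (x + y) * K y) -
      bump r x * (∫ y in (Metric.ball 0 a)ᶜ, K y) -
      9 / r ^ 2 * (∫ y in Metric.ball 0 a, ‖y‖ ^ (2 : ℝ) * K y) ≤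
      ∫ y, localDiff a (bump r) x y * K y := by
  have hint := hK.integrable_localDiff_bump hs hs1 hLam hr ha x
  have hKint := hK.integrableOn_compl_ball hLam hs ha
  have hwint : IntegrableOn (fun y => bump r (x + y) * K y) (Metric.ball (0 : Rd d) a)ᶜ := by
    refine Integrable.mono' hKint (((continuous_bump r).measurable.comp
      (measurable_const_add x)).aemeasurable.mul hK.aemeasurable).restrict.aestronglyMeasurable
      (Filter.Eventually.of_forall fun y => ?_)
    rw [norm_mul, Real.norm_of_nonneg (hK.nonneg y), Real.norm_of_nonneg (bump_nonneg r _)]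
    exact mul_le_of_le_one_left (hK.nonneg y) (bump_le_one r _)
  rw [← integral_add_compl measurableSet_ball hint]
  have h1 : -(9 / r ^ 2 * ∫ y in Metric.ball (0 : Rd d) a, ‖y‖ ^ (2 : ℝ) * K y) ≤
      ∫ y in Metric.ball (0 : Rd d) a, localDiff a (bump r) x y * K y := by
    rw [← integral_const_mul, ← integral_neg]
    refine setIntegral_mono_on
      ((hK.moment_ball hLam two_pos (by linarith) ha).1.const_mul (9 / r ^ 2)).neg
      hint.integrableOn measurableSet_ball fun y hy => ?_
    have := (abs_le.1 (localDiff_bump_abs_le hr x y hy)).1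
    rw [← mul_assoc, ← neg_mul]
    refine mul_le_mul_of_nonneg_right ?_ (hK.nonneg y)
    simpa using this
  have h2 : ∫ y in (Metric.ball (0 : Rd d) a)ᶜ, localDiff a (bump r) x y * K y =
      (∫ y in (Metric.ball 0 a)ᶜ, bump r (x + y) * K y) -
      bump r x * (∫ y in (Metric.ball 0 a)ᶜ, K y) := by
    rw [← integral_const_mul, ← integral_sub hwint (hKint.const_mul _)]
    refine setIntegral_congr_fun measurableSet_ball.compl fun y hy => ?_
    simp only [localDiff_of_notMem x hy]
    ring
  linarith

/-- The constant `|B_1|`. -/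
def unitVol (d : ℕ) : ℝ := (volume (Metric.ball (0 : Rd d) 1)).toReal

theorem unitVol_pos (d : ℕ) : 0 < unitVol d :=
  ENNReal.toReal_pos (Metric.measure_ball_pos _ _ one_pos).ne' measure_ball_lt_top.ne

theorem volume_real_ball (x : Rd d) {r : ℝ} (hr : 0 < r) :
    volume.real (Metric.ball x r) = r ^ d * unitVol d := by
  rw [Measure.real, Measure.addHaar_ball_of_pos volume x hr, ENNReal.toReal_mul,
    ENNReal.toReal_ofReal (by positivity), finrank_euclideanSpace_fin, unitVol]

theorem IsAdmissibleKernel.le_of_norm_le {s lam Lam ρ : ℝ} {K : Rd d → ℝ}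
    (hK : IsAdmissibleKernel s lam Lam ρ K) (hs : 0 < s) (hlam : 0 < lam) (hρ : 0 ≤ ρ) {r : ℝ}
    (hρr : ρ ≤ r) {y : Rd d} (hy0 : y ≠ 0) (hy : ‖y‖ ≤ r) :
    lam * r ^ (-(d : ℝ) - 2 * s) ≤ K y := by
  refine le_trans ?_ (hK.lower y hy0)
  have he : -(d : ℝ) - 2 * s ≤ 0 := by
    have : (0 : ℝ) ≤ d := Nat.cast_nonneg d
    linarith
  have h1 : r ^ (-(d : ℝ) - 2 * s) ≤ ‖y‖ ^ (-(d : ℝ) - 2 * s) :=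
    Real.rpow_le_rpow_of_nonpos (norm_pos_iff.2 hy0) hy he
  refine mul_le_mul_of_nonneg_left ?_ hlam.le
  unfold truncatedKernel
  split_ifs with h
  · exact h1
  · exact le_min h1 (Real.rpow_le_rpow_of_nonpos (lt_of_le_of_ne hρ (Ne.symm h)) hρr he)

/-- An admissible kernel charges every measurable set away from the origin. -/
theorem IsAdmissibleKernel.le_setIntegral {s lam Lam ρ : ℝ} {K : Rd d → ℝ}
    (hK : IsAdmissibleKernel s lam Lam ρ K) (hs : 0 < s) (hlam : 0 < lam) (hLam : 0 < Lam)
    (hρ : 0 ≤ ρ) {r a : ℝ} (ha : 0 < a) (hρr : ρ ≤ r) {S : Set (Rd d)}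
    (hS : NullMeasurableSet S volume) (hSr : S ⊆ Metric.closedBall 0 r)
    (hSa : S ⊆ (Metric.ball 0 a)ᶜ) :
    lam * r ^ (-(d : ℝ) - 2 * s) * volume.real S ≤ ∫ y in S, K y := by
  have hfin : volume S ≠ ⊤ := ((measure_mono hSr).trans_lt measure_closedBall_lt_top).ne
  calc lam * r ^ (-(d : ℝ) - 2 * s) * volume.real S
      = ∫ y in S, lam * r ^ (-(d : ℝ) - 2 * s) := by
        rw [setIntegral_const, smul_eq_mul, mul_comm]
    _ ≤ ∫ y in S, K y := by
        refine setIntegral_mono_on₀ (integrableOn_const hfin)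
          ((hK.integrableOn_compl_ball hLam hs ha).mono_set hSa) hS fun y hy => ?_
        refine hK.le_of_norm_le hs hlam hρ hρr ?_ (by simpa using hSr hy)
        rintro rfl
        exact hSa hy (Metric.mem_ball_self ha)

/-- From any `x` in `B_r`, jumps of length less than `2r` reach the core `B_{r/2}`, where the bump
is at least `9/16`. Removing the jumps shorter than `a ≤ r/4` leaves volume at least `(r/2)^d -
(r/4)^d ≥ (r/4)^d` (times `|B_1|`), and this is where `d ≥ 1` is used. -/
theorem IsAdmissibleKernel.le_integral_bump (hd : 1 ≤ d) {s lam Lam ρ : ℝ} {K : Rd d → ℝ}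
    (hK : IsAdmissibleKernel s lam Lam ρ K) (hs : 0 < s) (hlam : 0 < lam) (hLam : 0 < Lam)
    (hρ : 0 ≤ ρ) {r a : ℝ} (hr : 0 < r) (ha : 0 < a) (har : a ≤ r / 4) (hρr : ρ ≤ 2 * r)
    {x : Rd d} (hx : ‖x‖ < r) :
    9 / 16 * lam * 2 ^ (-(d : ℝ) - 2 * s) * (4⁻¹ ^ d * unitVol d) * r ^ (-(2 * s)) ≤
      ∫ y in (Metric.ball 0 a)ᶜ, bump r (x + y) * K y := by
  set S : Set (Rd d) := Metric.ball (-x) (r / 2) \ Metric.ball 0 a with hSdef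
  have hSm : MeasurableSet S := measurableSet_ball.diff measurableSet_ball
  have hSr : S ⊆ Metric.closedBall 0 (2 * r) := by
    intro y hy
    have h1 : ‖y + x‖ < r / 2 := by simpa [dist_eq_norm] using hy.1
    have h2 : ‖y‖ ≤ ‖y + x‖ + ‖x‖ := by simpa using norm_sub_le (y + x) x
    rw [mem_closedBall_zero_iff]
    linarith
  have hSa : S ⊆ (Metric.ball 0 a)ᶜ := fun y hy => hy.2
  have hvol : 4⁻¹ ^ d * unitVol d * r ^ d ≤ volume.real S := by
    have h1 : volume.real (Metric.ball (-x) (r / 2)) - volume.real (Metric.ball (0 : Rd d) a) ≤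
        volume.real S := le_measureReal_sdiff
    rw [volume_real_ball _ (by positivity), volume_real_ball _ ha] at h1
    have h2 : a ^ d ≤ 4⁻¹ ^ d * r ^ d := by
      rw [← mul_pow]
      exact pow_le_pow_left₀ ha.le (by linarith) d
    have h3 : 2 * (4⁻¹ ^ d * r ^ d) ≤ (r / 2) ^ d := by
      have h4 : (r / 2) ^ d = 2 ^ d * (4⁻¹ ^ d * r ^ d) := by
        rw [← mul_pow, ← mul_pow]; ring_nf
      rw [h4]
      refine mul_le_mul_of_nonneg_right ?_ (by positivity)
      calc (2 : ℝ) = 2 ^ 1 := by norm_num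
        _ ≤ 2 ^ d := pow_le_pow_right₀ (by norm_num) hd
    nlinarith [unitVol_pos d]
  have hKint := hK.integrableOn_compl_ball hLam hs ha
  have hwint : IntegrableOn (fun y => bump r (x + y) * K y) (Metric.ball (0 : Rd d) a)ᶜ := by
    refine Integrable.mono' hKint (((continuous_bump r).measurable.comp
      (measurable_const_add x)).aemeasurable.mul hK.aemeasurable).restrict.aestronglyMeasurable
      (Filter.Eventually.of_forall fun y => ?_)
    rw [norm_mul, Real.norm_of_nonneg (hK.nonneg y), Real.norm_of_nonneg (bump_nonneg r _)]
    exact mul_le_of_le_one_left (hK.nonneg y) (bump_le_one r _)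
  calc 9 / 16 * lam * 2 ^ (-(d : ℝ) - 2 * s) * (4⁻¹ ^ d * unitVol d) * r ^ (-(2 * s))
      = 9 / 16 * (lam * (2 * r) ^ (-(d : ℝ) - 2 * s) * (4⁻¹ ^ d * unitVol d * r ^ d)) := by
        have : r ^ (-(2 * s)) = r ^ (-(d : ℝ) - 2 * s) * r ^ d := by
          rw [← Real.rpow_natCast, ← Real.rpow_add hr]; ring_nf
        rw [this, Real.mul_rpow (by norm_num) hr.le]
        ring
    _ ≤ 9 / 16 * (lam * (2 * r) ^ (-(d : ℝ) - 2 * s) * volume.real S) := by gcongr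
    _ ≤ 9 / 16 * ∫ y in S, K y := by
        gcongr
        exact hK.le_setIntegral hs hlam hLam hρ ha hρr hSm.nullMeasurableSet hSr hSa
    _ = ∫ y in S, 9 / 16 * K y := (integral_const_mul _ _).symm
    _ ≤ ∫ y in S, bump r (x + y) * K y := by
        refine setIntegral_mono_on ((hKint.mono_set hSa).const_mul _) (hwint.mono_set hSa) hSm
          fun y hy => mul_le_mul_of_nonneg_right (le_bump hr ?_) (hK.nonneg y)
        have h1 : ‖y + x‖ < r / 2 := by simpa [dist_eq_norm] using hy.1
        rw [add_comm]
        exact h1.le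
    _ ≤ ∫ y in (Metric.ball 0 a)ᶜ, bump r (x + y) * K y :=
        setIntegral_mono_set hwint (Filter.Eventually.of_forall fun y =>
          mul_nonneg (bump_nonneg r _) (hK.nonneg y)) hSa.eventuallyLE

theorem IsAdmissibleKernel.integrable_diffOp_bump {s lam Lam ρ : ℝ} {K : Rd d → ℝ}
    (hK : IsAdmissibleKernel s lam Lam ρ K) (hs : 0 < s) (hs1 : s < 1) (hLam : 0 < Lam) {r : ℝ}
    (hr : 0 < r) (x : Rd d) : Integrable (fun y => diffOp s y (bump r) x * K y) := by
  obtain ⟨D, -, hD⟩ := exists_drift_bound hs1 hLam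
  have h := (hD d lam ρ K hK 1 one_pos (bump r) x).1.add
    (hK.integrable_localDiff_bump hs hs1 hLam hr one_pos x)
  refine h.congr (Filter.Eventually.of_forall fun y => ?_)
  simp only [Pi.add_apply]
  ring

/-- The bump function is a subsolution of the linear equation up to a zeroth order term,
uniformly in the kernel, the drift and the scale. -/
theorem exists_bump_bound (hd : 1 ≤ d) {s lam Lam b₀ : ℝ} (hs : 0 < s) (hs1 : s < 1)
    (hlam : 0 < lam) (hLam : 0 < Lam) (hb₀ : 0 ≤ b₀) :
    ∃ C : ℝ, 0 ≤ C ∧ ∀ (ρ r b : ℝ) (K : Rd d → ℝ) (x : Rd d), 0 ≤ ρ → 0 < r → ρ ≤ 2 * r →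
      IsAdmissibleKernel s lam Lam ρ K → b * r ^ (2 * s - 1) ≤ b₀ → ‖x‖ < r →
      -linearOp s K (bump r) x + b * ‖bumpGrad r x‖ ≤ C * r ^ (-(2 * s)) * bump r x := by
  obtain ⟨D, hD0, hD⟩ := exists_drift_bound hs1 hLam
  set c : ℝ := 9 / 16 * lam * 2 ^ (-(d : ℝ) - 2 * s) * (4⁻¹ ^ d * unitVol d) with hc
  have hcpos : 0 < c := by have := unitVol_pos d; positivity
  set M2 : ℝ := 2 ^ (2 : ℝ) * Lam / (1 - 2 ^ (2 * s - 2)) with hM2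
  set M0 : ℝ := Lam / (1 - 2 ^ (-(2 * s))) with hM0
  have hM2pos : 0 < M2 := by
    have := two_rpow_lt_one (show 2 * s - 2 < 0 by linarith)
    exact div_pos (by positivity) (by linarith)
  have hM0pos : 0 < M0 := by
    have := two_rpow_lt_one (show -(2 * s) < 0 by linarith)
    exact div_pos (by positivity) (by linarith)
  -- The cutoff radius is `σ * r`, with `σ` so small that the second order error from short jumps
  -- costs at most half of the gain `c`.
  obtain ⟨σ, hσ0, hσ4, hσ⟩ : ∃ σ : ℝ, 0 < σ ∧ σ ≤ 1 / 4 ∧ 9 * M2 * σ ^ (2 - 2 * s) ≤ c / 2 := by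
    have he : 0 < 2 - 2 * s := by linarith
    set τ := (c / (18 * M2)) ^ (1 / (2 - 2 * s)) with hτ
    have hτ0 : 0 < τ := by positivity
    refine ⟨min (1 / 4) τ, lt_min (by norm_num) hτ0, min_le_left _ _, ?_⟩
    calc 9 * M2 * (min (1 / 4) τ) ^ (2 - 2 * s) ≤ 9 * M2 * τ ^ (2 - 2 * s) := by
          gcongr
          exact min_le_right _ _
      _ = c / 2 := by
          rw [hτ, ← Real.rpow_mul (by positivity), one_div_mul_cancel he.ne', Real.rpow_one]
          field_simp
          norm_num
  -- `E` is the total drift in scale-invariant units: the part from moving the gradient correction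
  -- plus the given one.
  set E : ℝ := D * σ ^ (1 - 2 * s) + b₀ with hE
  have hE0 : 0 ≤ E := by positivity
  refine ⟨M0 * σ ^ (-(2 * s)) + 8 * E ^ 2 / c, by positivity,
    fun ρ r b K x hρ hr hρr hK hb hx => ?_⟩
  set a := σ * r with ha
  have ha0 : 0 < a := by positivity
  have h1 := hK.le_integral_localDiff_bump hs hs1 hLam hr ha0 x
  have h2 := hK.le_integral_bump hd hs hlam hLam hρ hr ha0 (by rw [ha]; nlinarith) hρr hx
  have h3 := hK.integral_compl_ball_le hLam hs ha0
  have h4 := (hK.moment_ball hLam two_pos (by linarith) ha0).2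
  obtain ⟨h5, h6⟩ := hD d lam ρ K hK a ha0 (bump r) x
  have h7 : linearOp s K (bump r) x = (∫ y, (diffOp s y (bump r) x -
      localDiff a (bump r) x y) * K y) + ∫ y, localDiff a (bump r) x y * K y := by
    rw [← integral_add h5 (hK.integrable_localDiff_bump hs hs1 hLam hr ha0 x), linearOp]
    congr with y
    ring
  have h8 := (abs_le.1 h6).1
  rw [gradient_bump hr] at h8
  have hz := norm_bumpGrad_le hr x
  set z := cap r x with hzdef
  have hz0 : 0 ≤ z := cap_nonneg r x
  have hzb : bump r x = z ^ 2 := rfl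
  set q := r ^ (-(2 * s)) with hq
  have hq0 : 0 < q := by positivity
  have e1 : a ^ (-(2 * s)) = σ ^ (-(2 * s)) * q := by rw [ha, Real.mul_rpow hσ0.le hr.le]
  have e2 : 9 / r ^ 2 * a ^ (2 - 2 * s) = 9 * σ ^ (2 - 2 * s) * q := by
    rw [ha, Real.mul_rpow hσ0.le hr.le, hq, sub_eq_add_neg 2 (2 * s), Real.rpow_add hr]
    simp only [Real.rpow_two]
    field_simp
  have e3 : a ^ (1 - 2 * s) = σ ^ (1 - 2 * s) * q * r := by
    rw [ha, Real.mul_rpow hσ0.le hr.le, hq, sub_eq_add_neg 1 (2 * s), Real.rpow_add hr,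
      Real.rpow_one]
    ring
  have e4 : b ≤ b₀ * q * r := by
    have : r ^ (2 * s - 1) * (q * r) = 1 := by
      rw [hq, ← Real.rpow_add_one hr.ne', ← Real.rpow_add hr]
      ring_nf
      exact Real.rpow_zero r
    calc b = b * r ^ (2 * s - 1) * (q * r) := by rw [mul_assoc, this, mul_one]
      _ ≤ b₀ * (q * r) := mul_le_mul_of_nonneg_right hb (by positivity)
      _ = b₀ * q * r := by ring
  have f1 : 9 / r ^ 2 * (∫ y in Metric.ball (0 : Rd d) a, ‖y‖ ^ (2 : ℝ) * K y) ≤ c / 2 * q := by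
    calc 9 / r ^ 2 * (∫ y in Metric.ball (0 : Rd d) a, ‖y‖ ^ (2 : ℝ) * K y)
        ≤ 9 / r ^ 2 * (M2 * a ^ (2 - 2 * s)) := by gcongr
      _ = M2 * (9 / r ^ 2 * a ^ (2 - 2 * s)) := by ring
      _ = 9 * M2 * σ ^ (2 - 2 * s) * q := by rw [e2]; ring
      _ ≤ c / 2 * q := by gcongr
  have f2 : bump r x * (∫ y in (Metric.ball (0 : Rd d) a)ᶜ, K y) ≤
      M0 * σ ^ (-(2 * s)) * q * z ^ 2 := by
    rw [hzb]
    calc z ^ 2 * (∫ y in (Metric.ball (0 : Rd d) a)ᶜ, K y) ≤ z ^ 2 * (M0 * a ^ (-(2 * s))) := by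
          gcongr
      _ = M0 * σ ^ (-(2 * s)) * q * z ^ 2 := by rw [e1]; ring
  have f3 : D * a ^ (1 - 2 * s) * ‖bumpGrad r x‖ + b * ‖bumpGrad r x‖ ≤ E * q * (4 * z) := by
    calc D * a ^ (1 - 2 * s) * ‖bumpGrad r x‖ + b * ‖bumpGrad r x‖
        ≤ D * a ^ (1 - 2 * s) * ‖bumpGrad r x‖ + b₀ * q * r * ‖bumpGrad r x‖ := by gcongr
      _ = E * q * (r * ‖bumpGrad r x‖) := by rw [e3, hE]; ring
      _ ≤ E * q * (4 * z) := by gcongr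
  -- Young's inequality spends the other half of the gain on the drift; the rest is a multiple of `z
  -- ^ 2`, which is the bump itself.
  have f4 : E * (4 * z) ≤ c / 2 + 8 * E ^ 2 / c * z ^ 2 := by
    have : c / 2 + 8 * E ^ 2 / c * z ^ 2 - E * (4 * z) = (c - 4 * E * z) ^ 2 / (2 * c) := by
      field_simp
      ring
    rw [← sub_nonneg, this]
    positivity
  have f5 : E * q * (4 * z) ≤ (c / 2 + 8 * E ^ 2 / c * z ^ 2) * q := by
    calc E * q * (4 * z) = E * (4 * z) * q := by ring
      _ ≤ _ := by gcongr
  rw [hzb]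
  rw [← hc] at h2
  rw [h7]
  have : (M0 * σ ^ (-(2 * s)) + 8 * E ^ 2 / c) * q * z ^ 2 =
    M0 * σ ^ (-(2 * s)) * q * z ^ 2 + 8 * E ^ 2 / c * z ^ 2 * q := by ring
  rw [this]
  linarith

/-! ### The extremal operator at a touching point -/

/-- The constant bounding the contribution of the tail `(|x|/r)^s` to the extremal operator. -/
def tailConst (s Lam : ℝ) : ℝ := 2 ^ s * (2 ^ s * Lam / (1 - 2 ^ (s - 2 * s)))

theorem tailConst_pos {s Lam : ℝ} (hs : 0 < s) (hLam : 0 < Lam) : 0 < tailConst s Lam := by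
  have := two_rpow_lt_one (show s - 2 * s < 0 by linarith)
  have h : 0 < 1 - (2 : ℝ) ^ (s - 2 * s) := by linarith
  unfold tailConst
  positivity

/-- `v` coincides near `x₀` with the barrier `k - B η_r`, lies below it in `B_{2r}`, by the amount
`h` on a set `S`, and grows at most like `(|x|/r)^s`. -/
structure TouchesBarrier (s r ε k B N h : ℝ) (S : Set (Rd d)) (x₀ : Rd d) (v : Rd d → ℝ) :
    Prop where
  aemeasurable : AEMeasurable v volume
  bounded : ∃ M, ∀ x, |v x| ≤ M
  eq_near : ∀ x ∈ Metric.ball x₀ ε, v x = k - B * bump r x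
  le_inside : ∀ x ∈ Metric.ball (0 : Rd d) (2 * r), v x ≤ k - B * bump r x
  le_outside : ∀ x ∉ Metric.ball (0 : Rd d) (2 * r), v x ≤ k + N * (‖x‖ / r) ^ s
  nullMeasurableSet : NullMeasurableSet S volume
  subset_ball : S ⊆ Metric.ball 0 r
  le_on : ∀ x ∈ S, x ∉ Metric.ball x₀ ε → v x ≤ k - B * bump r x - h

theorem hasGradientAt_barrier {r : ℝ} (hr : 0 < r) (k B : ℝ) (x : Rd d) :
    HasGradientAt (fun x => k - B * bump r x) ((-B) • bumpGrad r x) x := by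
  have h := (hasGradientAt_bump hr x).hasFDerivAt
  rw [hasGradientAt_iff_hasFDerivAt]
  have h2 := (h.const_mul B).const_sub k
  have he : (InnerProductSpace.toDual ℝ (Rd d)) ((-B) • bumpGrad r x) =
      -(B • (InnerProductSpace.toDual ℝ (Rd d)) (bumpGrad r x)) := by
    ext y
    simp
  rw [he]
  exact h2

theorem TouchesBarrier.gradient_eq {s r ε k B N h : ℝ} {S : Set (Rd d)} {x₀ : Rd d} {v : Rd d → ℝ}
    (hv : TouchesBarrier s r ε k B N h S x₀ v) (hr : 0 < r) (hε : 0 < ε) :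
    gradient v x₀ = (-B) • bumpGrad r x₀ := by
  refine HasGradientAt.gradient ?_
  have heq : v =ᶠ[nhds x₀] fun x => k - B * bump r x :=
    Filter.eventually_of_mem (Metric.ball_mem_nhds x₀ hε) hv.eq_near
  exact (hasGradientAt_barrier hr k B x₀).congr_of_eventuallyEq heq

theorem TouchesBarrier.diffOp_eq {s r ε k B N h : ℝ} {S : Set (Rd d)} {x₀ : Rd d} {v : Rd d → ℝ}
    (hv : TouchesBarrier s r ε k B N h S x₀ v) (hr : 0 < r) (hε : 0 < ε) (y : Rd d) :
    diffOp s y v x₀ = -B * diffOp s y (bump r) x₀ +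
      (v (x₀ + y) - (k - B * bump r (x₀ + y))) := by
  have h1 := hv.eq_near x₀ (Metric.mem_ball_self hε)
  have h2 := hv.gradient_eq hr hε
  simp only [diffOp, h2, gradient_bump hr, h1, inner_smul_right]
  split_ifs
  · ring
  · by_cases hy : y ∈ Metric.ball (0 : Rd d) 1
    · simp only [indicator_of_mem hy]
      ring
    · simp only [indicator_of_notMem hy]
      ring
  · ring

/-- Write `v` as the barrier plus a remainder `w` that vanishes in `B_ε(x₀)`. The sign of `w` may be
used jump by jump: it is nonpositive for jumps into `B_{2r}`, at most `-h` for jumps into `S` off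
`B_ε(x₀)`, and bounded by the tail otherwise. -/
theorem TouchesBarrier.linearOp_le {s lam Lam ρ r ε k B N h : ℝ} {S : Set (Rd d)} {x₀ : Rd d}
    {v : Rd d → ℝ} (hv : TouchesBarrier s r ε k B N h S x₀ v) {K : Rd d → ℝ}
    (hK : IsAdmissibleKernel s lam Lam ρ K) (hs : 0 < s) (hs1 : s < 1) (hlam : 0 < lam)
    (hLam : 0 < Lam) (hρ : 0 ≤ ρ) (hr : 0 < r) (hρr : ρ ≤ 2 * r) (hε : 0 < ε) (hN : 0 ≤ N)
    (hh : 0 ≤ h) (hx₀ : ‖x₀‖ < r) :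
    linearOp s K v x₀ ≤ -B * linearOp s K (bump r) x₀ + N * tailConst s Lam * r ^ (-(2 * s)) -
      h * (lam * (2 * r) ^ (-(d : ℝ) - 2 * s) *
        (volume.real S - volume.real (Metric.ball x₀ ε))) := by
  set w : Rd d → ℝ := fun y => v (x₀ + y) - (k - B * bump r (x₀ + y)) with hw
  set G : Set (Rd d) := (fun y => x₀ + y) ⁻¹' (S \ Metric.ball x₀ ε) with hG
  set T : Rd d → ℝ := (Metric.ball (0 : Rd d) r)ᶜ.indicator
    fun y => N * 2 ^ s * r ^ (-s) * (‖y‖ ^ s * K y) with hT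
  have hqmp : Measure.QuasiMeasurePreserving (fun y : Rd d => x₀ + y) volume volume :=
    (measurePreserving_add_left volume x₀).quasiMeasurePreserving
  have hw0 : ∀ y ∈ Metric.ball (0 : Rd d) ε, w y = 0 := fun y hy => by
    simp only [hw]
    rw [hv.eq_near (x₀ + y) (by simpa [mem_ball_iff_norm] using hy), sub_self]
  have hKint := hK.integrableOn_compl_ball hLam hs hε
  have hwm : AEMeasurable w volume :=
    (hv.aemeasurable.comp_quasiMeasurePreserving hqmp).sub
      (aemeasurable_const.sub (((continuous_bump r).measurable.comp
        (measurable_const_add x₀)).aemeasurable.const_mul B))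
  -- Since `w` vanishes for `|y| < ε`, boundedness suffices despite the singularity of `K`.
  have hwint : Integrable (fun y => w y * K y) := by
    obtain ⟨M, hM⟩ := hv.bounded
    have heq : (fun y => w y * K y) = (Metric.ball (0 : Rd d) ε)ᶜ.indicator
        fun y => w y * K y := by
      ext y
      by_cases hy : y ∈ Metric.ball (0 : Rd d) ε
      · simp [hy, hw0 y hy]
      · simp [hy]
    rw [heq, integrable_indicator_iff measurableSet_ball.compl]
    refine Integrable.mono' (hKint.const_mul (M + (|k| + |B|)))
      (hwm.mul hK.aemeasurable).restrict.aestronglyMeasurable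
      (Filter.Eventually.of_forall fun y => ?_)
    rw [norm_mul, Real.norm_of_nonneg (hK.nonneg y)]
    refine mul_le_mul_of_nonneg_right ?_ (hK.nonneg y)
    have h2 : |B * bump r (x₀ + y)| ≤ |B| := by
      rw [abs_mul, abs_of_nonneg (bump_nonneg r _)]
      exact mul_le_of_le_one_right (abs_nonneg B) (bump_le_one r _)
    calc |w y| ≤ |v (x₀ + y)| + |k - B * bump r (x₀ + y)| := abs_sub _ _
      _ ≤ M + (|k| + |B|) := add_le_add (hM _) ((abs_sub _ _).trans (by gcongr))
  have hTint : Integrable T := by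
    rw [hT, integrable_indicator_iff measurableSet_ball.compl]
    exact (hK.moment_compl_ball hLam hs.le (by linarith) hr).1.const_mul _
  have hTle : ∫ y, T y ≤ N * tailConst s Lam * r ^ (-(2 * s)) := by
    rw [hT, integral_indicator measurableSet_ball.compl, integral_const_mul]
    calc N * 2 ^ s * r ^ (-s) * ∫ y in (Metric.ball (0 : Rd d) r)ᶜ, ‖y‖ ^ s * K y
        ≤ N * 2 ^ s * r ^ (-s) *
          (2 ^ s * Lam / (1 - 2 ^ (s - 2 * s)) * r ^ (s - 2 * s)) := by
          gcongr
          exact (hK.moment_compl_ball hLam hs.le (by linarith) hr).2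
      _ = N * tailConst s Lam * r ^ (-(2 * s)) := by
          have : r ^ (-(2 * s)) = r ^ (-s) * r ^ (s - 2 * s) := by
            rw [← Real.rpow_add hr]; ring_nf
          rw [this, tailConst]
          ring
  have hGm : NullMeasurableSet G volume :=
    (hv.nullMeasurableSet.diff measurableSet_ball.nullMeasurableSet).preimage hqmp
  have hGa : G ⊆ (Metric.ball 0 ε)ᶜ := by
    intro y hy hy'
    exact hy.2 (by simpa [mem_ball_iff_norm] using hy')
  have hGr : G ⊆ Metric.closedBall 0 (2 * r) := by
    intro y hy
    have h1 : ‖x₀ + y‖ < r := by simpa using hv.subset_ball hy.1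
    have h2 : ‖y‖ ≤ ‖x₀ + y‖ + ‖x₀‖ := by simpa using norm_sub_le (x₀ + y) x₀
    rw [mem_closedBall_zero_iff]
    linarith
  have hGK := hK.le_setIntegral hs hlam hLam hρ hε hρr hGm hGr hGa
  have hGint : Integrable (G.indicator K) :=
    (hKint.mono_set hGa).integrable_indicator₀ hGm
  have hGvol : volume.real S - volume.real (Metric.ball x₀ ε) ≤ volume.real G := by
    have : volume.real G = volume.real (S \ Metric.ball x₀ ε) := by
      rw [Measure.real, hG, measure_preimage_add, Measure.real]
    rw [this]
    exact le_measureReal_sdiff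
  have hpt : ∀ y, w y * K y ≤ T y - h * G.indicator K y := by
    intro y
    have hK0 := hK.nonneg y
    have hT0 : 0 ≤ T y := by
      rw [hT]
      exact indicator_nonneg (fun y _ => mul_nonneg (by positivity)
        (mul_nonneg (by positivity) (hK.nonneg y))) y
    by_cases hyG : y ∈ G
    · rw [indicator_of_mem hyG]
      have := hv.le_on _ hyG.1 hyG.2
      have hwy : w y ≤ -h := by simp only [hw]; linarith
      nlinarith
    · rw [indicator_of_notMem hyG, mul_zero, sub_zero]
      by_cases hy : x₀ + y ∈ Metric.ball (0 : Rd d) (2 * r)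
      · have := hv.le_inside _ hy
        have hwy : w y ≤ 0 := by simp only [hw]; linarith
        nlinarith
      · have h1 := hv.le_outside _ hy
        rw [mem_ball_zero_iff, not_lt] at hy
        have h2 : ‖x₀ + y‖ ≤ ‖x₀‖ + ‖y‖ := norm_add_le _ _
        have hyr : y ∈ (Metric.ball (0 : Rd d) r)ᶜ := by
          rw [mem_compl_iff, mem_ball_zero_iff, not_lt]; linarith
        rw [hT, indicator_of_mem hyr]
        -- A jump from `B_r` to outside `B_{2r}` has `|y| ≥ r > |x₀|`, so `|x₀ + y| ≤ 2|y|`. The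
        -- exponent `s < 2 * s` makes the resulting moment finite.
        have h3 : (‖x₀ + y‖ / r) ^ s ≤ 2 ^ s * r ^ (-s) * ‖y‖ ^ s := by
          calc (‖x₀ + y‖ / r) ^ s ≤ (2 * r⁻¹ * ‖y‖) ^ s := by
                refine Real.rpow_le_rpow (by positivity) ?_ hs.le
                rw [div_le_iff₀ hr]
                have : 2 * r⁻¹ * ‖y‖ * r = 2 * ‖y‖ := by field_simp
                linarith
            _ = _ := by
                rw [Real.mul_rpow (by positivity) (norm_nonneg y),
                  Real.mul_rpow (by norm_num) (by positivity), Real.inv_rpow hr.le,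
                  Real.rpow_neg hr.le]
        have hwy : w y ≤ N * (2 ^ s * r ^ (-s) * ‖y‖ ^ s) := by
          have : w y ≤ N * (‖x₀ + y‖ / r) ^ s := by
            simp only [hw, bump_eq_zero hr (show r ≤ ‖x₀ + y‖ by linarith)]
            linarith
          exact this.trans (mul_le_mul_of_nonneg_left h3 hN)
        calc w y * K y ≤ N * (2 ^ s * r ^ (-s) * ‖y‖ ^ s) * K y :=
              mul_le_mul_of_nonneg_right hwy hK0
          _ = _ := by ring
  have hwle : ∫ y, w y * K y ≤ (∫ y, T y) - h * ∫ y in G, K y := by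
    calc ∫ y, w y * K y ≤ ∫ y, (T y - h * G.indicator K y) :=
          integral_mono hwint (hTint.sub (hGint.const_mul h)) hpt
      _ = _ := by
          rw [integral_sub hTint (hGint.const_mul h), integral_const_mul, integral_indicator₀ hGm]
  have hlin : linearOp s K v x₀ = -B * linearOp s K (bump r) x₀ + ∫ y, w y * K y := by
    rw [linearOp, linearOp, ← integral_const_mul, ← integral_add
      ((hK.integrable_diffOp_bump hs hs1 hLam hr x₀).const_mul (-B)) hwint]
    congr with y
    rw [hv.diffOp_eq hr hε y]
    ring
  have hfin : h * (lam * (2 * r) ^ (-(d : ℝ) - 2 * s) *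
      (volume.real S - volume.real (Metric.ball x₀ ε))) ≤ h * ∫ y in G, K y := by
    refine mul_le_mul_of_nonneg_left (le_trans ?_ hGK) hh
    exact mul_le_mul_of_nonneg_left hGvol (by positivity)
  rw [hlin]
  linarith

/-- The extremal operator with drift at a touching point, where `C` is the constant of the
barrier estimate `exists_bump_bound`. -/
theorem TouchesBarrier.pucciSup_le {s lam Lam ρ r ε k B N h b C : ℝ} {S : Set (Rd d)} {x₀ : Rd d}
    {v : Rd d → ℝ} (hv : TouchesBarrier s r ε k B N h S x₀ v) (hs : 0 < s) (hs1 : s < 1)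
    (hlam : 0 < lam) (hLam : 0 < Lam) (hρ : 0 ≤ ρ) (hr : 0 < r) (hρr : ρ ≤ 2 * r) (hε : 0 < ε)
    (hB : 0 ≤ B) (hN : 0 ≤ N) (hh : 0 ≤ h) (hx₀ : ‖x₀‖ < r)
    (hne : (kernelClass d s lam Lam ρ).Nonempty)
    (hC : ∀ K : Rd d → ℝ, IsAdmissibleKernel s lam Lam ρ K →
      -linearOp s K (bump r) x₀ + b * ‖bumpGrad r x₀‖ ≤ C * r ^ (-(2 * s)) * bump r x₀) :
    b * ‖gradient v x₀‖ + pucciSup s lam Lam ρ v x₀ ≤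
      B * (C * r ^ (-(2 * s)) * bump r x₀) + N * tailConst s Lam * r ^ (-(2 * s)) -
      h * (lam * (2 * r) ^ (-(d : ℝ) - 2 * s) *
        (volume.real S - volume.real (Metric.ball x₀ ε))) := by
  rw [hv.gradient_eq hr hε, norm_smul, norm_neg, Real.norm_of_nonneg hB, ← le_sub_iff_add_le']
  refine csSup_le (hne.image _) ?_
  rintro _ ⟨K, hK, rfl⟩
  have h1 := hv.linearOp_le hK hs hs1 hlam hLam hρ hr hρr hε hN hh hx₀
  have h2 := mul_le_mul_of_nonneg_left (hC K hK) hB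
  linarith

/-! ### Testing a subsolution with a barrier -/

/-- In space the barrier is only `C^{1,1}`, because the bump is the square of a positive part; the
test class admits exactly this regularity. -/
theorem isTestFunction_barrier {r : ℝ} (hr : 0 < r) {ℓ β : ℝ → ℝ} (hℓ : Differentiable ℝ ℓ)
    (hβ : Differentiable ℝ β) (x₀ : Rd d) (t₀ ε : ℝ) :
    IsTestFunction x₀ t₀ ε fun x t => ℓ t - β t * bump r x where
  time x _ t _ := ((hℓ t).sub ((hβ t).mul_const _)).differentiableWithinAt
  space t _ := by
    refine ⟨fun x _ => (hasGradientAt_barrier hr (ℓ t) (β t) x).hasFDerivAt.differentiableAt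
      |>.differentiableWithinAt, ?_⟩
    obtain ⟨L, hL⟩ := lipschitzOnWith_bumpGrad hr x₀ ε
    refine ⟨‖-β t‖₊ * L, ?_⟩
    have heq : gradient (fun x : Rd d => ℓ t - β t * bump r x) = fun x => (-β t) • bumpGrad r x :=
      funext fun x => (hasGradientAt_barrier hr (ℓ t) (β t) x).gradient
    rw [heq]
    refine LipschitzOnWith.of_dist_le_mul fun x hx y hy => ?_
    rw [dist_eq_norm, ← smul_sub, norm_smul, NNReal.coe_mul, coe_nnnorm, mul_assoc]
    gcongr
    rw [← dist_eq_norm]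
    exact hL.dist_le_mul x hx y hy

theorem glue_slice {x₀ : Rd d} {t₀ ε : ℝ} (hε : 0 < ε) (φ u : Rd d → ℝ → ℝ) {x : Rd d} :
    (x ∈ Metric.ball x₀ ε → glue x₀ t₀ ε φ u x t₀ = φ x t₀) ∧
      (x ∉ Metric.ball x₀ ε → glue x₀ t₀ ε φ u x t₀ = u x t₀) := by
  have ht : t₀ ∈ Ioc (t₀ - ε) t₀ := ⟨by linarith, le_rfl⟩
  constructor
  · intro hx
    exact if_pos ⟨hx, ht⟩
  · intro hx
    exact if_neg fun h => hx h.1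

theorem leftDeriv_glue {x₀ : Rd d} {t₀ ε : ℝ} (hε : 0 < ε) {φ u : Rd d → ℝ → ℝ} {φ' : ℝ}
    (hφ : HasDerivAt (φ x₀) φ' t₀) : leftDeriv (glue x₀ t₀ ε φ u x₀) t₀ = φ' := by
  have heq : ∀ t ∈ Ioc (t₀ - ε) t₀, glue x₀ t₀ ε φ u x₀ t = φ x₀ t := fun t ht =>
    if_pos ⟨Metric.mem_ball_self hε, ht⟩
  have hmem : Ioc (t₀ - ε) t₀ ∈ nhdsWithin t₀ (Iic t₀) := Ioc_mem_nhdsLE (by linarith)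
  have h : HasDerivWithinAt (glue x₀ t₀ ε φ u x₀) φ' (Iic t₀) t₀ :=
    hφ.hasDerivWithinAt.congr_of_eventuallyEq (Filter.eventually_of_mem hmem heq)
      (heq t₀ ⟨by linarith, le_rfl⟩)
  exact h.derivWithin (uniqueDiffWithinAt_Iic t₀)

theorem aemeasurable_of_eq_on_off {B : Set (Rd d)} (hB : MeasurableSet B) {f g v : Rd d → ℝ}
    (hf : AEMeasurable f volume) (hg : AEMeasurable g volume) (h1 : ∀ x ∈ B, v x = f x)
    (h2 : ∀ x ∉ B, v x = g x) : AEMeasurable v volume := by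
  have : v = B.indicator f + Bᶜ.indicator g := by
    ext x
    by_cases hx : x ∈ B
    · simp [hx, h1 x hx]
    · simp [hx, h2 x hx]
  rw [this]
  exact (hf.indicator hB).add (hg.indicator hB.compl)

theorem timeInterval_mono {s r R : ℝ} (hs : 0 < s) (hr : 0 ≤ r) (hrR : r ≤ R) :
    timeInterval s r ⊆ timeInterval s R :=
  Ioc_subset_Ioc_left (neg_le_neg (Real.rpow_le_rpow hr hrR (by linarith)))

/-- If a subsolution is touched from above by `ℓ(t) - β(t) η_r(x)`, then the equation yields an
inequality in which the measure of a sublevel set at the time of touching appears. -/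
theorem IsViscositySubsolution.barrier_inequality (hd : 1 ≤ d) {s lam Lam ρ r R b A C : ℝ}
    {u : Rd d → ℝ → ℝ}
    (hu : IsViscositySubsolution (fun w x => b * ‖gradient w x‖ + pucciSup s lam Lam ρ w x)
      (fun _ _ => A) (Metric.ball 0 R) (timeInterval s R) u)
    (hs : 0 < s) (hs1 : s < 1) (hlam : 0 < lam) (hLam : 0 < Lam) (hρ : 0 ≤ ρ) (hr : 0 < r)
    (hρr : ρ ≤ 2 * r) (hrR : 2 * r ≤ R) (hne : (kernelClass d s lam Lam ρ).Nonempty)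
    {a c N : ℝ} (ha : 0 < a) (hN : 0 ≤ N) {x₀ : Rd d} {t₀ : ℝ} (hx₀ : ‖x₀‖ < r)
    (ht₀ : t₀ ∈ timeInterval s (2 * r))
    (hC : ∀ K : Rd d → ℝ, IsAdmissibleKernel s lam Lam ρ K →
      -linearOp s K (bump r) x₀ + b * ‖bumpGrad r x₀‖ ≤ C * r ^ (-(2 * s)) * bump r x₀)
    (hout : ∀ x ∉ Metric.ball (0 : Rd d) (2 * r), u x t₀ ≤ c + a + N * (‖x‖ / r) ^ s)
    {ℓ β : ℝ → ℝ} (hℓ : Differentiable ℝ ℓ) (hβ : Differentiable ℝ β) {ℓ' β' : ℝ}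
    (hℓ' : HasDerivAt ℓ ℓ' t₀) (hβ' : HasDerivAt β β' t₀) (hβ0 : 0 ≤ β t₀) (hβa : β t₀ ≤ a / 2)
    (hℓa : c + a ≤ ℓ t₀) {δ : ℝ} (hδ : 0 < δ) (heq : u x₀ t₀ = ℓ t₀ - β t₀ * bump r x₀)
    (hle : ∀ x ∈ Metric.ball (0 : Rd d) (2 * r), ∀ t ∈ timeInterval s (2 * r), t ∈ Ioc (t₀ - δ) t₀ →
      u x t ≤ ℓ t - β t * bump r x) :
    ℓ' - β' * bump r x₀ ≤ A + β t₀ * (C * r ^ (-(2 * s)) * bump r x₀) +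
      N * tailConst s Lam * r ^ (-(2 * s)) - a / 2 * (lam * (2 * r) ^ (-(d : ℝ) - 2 * s) *
        volume.real {x ∈ Metric.ball (0 : Rd d) r | u x t₀ ≤ c}) := by
  -- Replacing `u` by the test function in `B_ε(x₀)` loses that ball from the sublevel set. Its
  -- volume costs at most `e` for small `ε`, and `e` is arbitrary.
  refine le_of_forall_pos_le_add fun e he => ?_
  set Q : ℝ := a / 2 * (lam * (2 * r) ^ (-(d : ℝ) - 2 * s)) with hQ
  have hQ0 : 0 < Q := by positivity
  have hω := unitVol_pos d
  obtain ⟨ε, hε, hε1, hεr, hεδ, hεt, hεe⟩ : ∃ ε : ℝ, 0 < ε ∧ ε ≤ 1 ∧ ε ≤ r ∧ ε ≤ δ ∧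
      -((2 * r) ^ (2 * s)) ≤ t₀ - ε ∧ ε ≤ e / (Q * unitVol d) := by
    have h1 : 0 < t₀ + (2 * r) ^ (2 * s) := by linarith [ht₀.1]
    refine ⟨min (min 1 r) (min δ (min (t₀ + (2 * r) ^ (2 * s)) (e / (Q * unitVol d)))),
      by positivity, by simp, by simp, by simp, ?_, by simp⟩
    have : min (min 1 r) (min δ (min (t₀ + (2 * r) ^ (2 * s)) (e / (Q * unitVol d)))) ≤
      t₀ + (2 * r) ^ (2 * s) := by simp
    linarith
  have hball : Metric.ball x₀ ε ⊆ Metric.ball 0 (2 * r) := by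
    intro x hx
    rw [mem_ball_iff_norm] at hx
    have : ‖x‖ ≤ ‖x₀‖ + ‖x - x₀‖ := by simpa using norm_add_le x₀ (x - x₀)
    rw [mem_ball_zero_iff]
    linarith
  have htime : ∀ t ∈ Ioc (t₀ - ε) t₀, t ∈ timeInterval s (2 * r) := fun t ht =>
    ⟨by linarith [ht.1], ht.2.trans ht₀.2⟩
  have hI := timeInterval_mono hs (by positivity) hrR
  have hB := Metric.ball_subset_ball (x := (0 : Rd d)) hrR
  have hZ : backwardCylinder x₀ t₀ ε ⊆ Metric.ball 0 R ×ˢ timeInterval s R := fun p hp =>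
    ⟨hB (hball hp.1), hI (htime p.2 hp.2)⟩
  set φ : Rd d → ℝ → ℝ := fun x t => ℓ t - β t * bump r x with hφ
  have htouch := hu.touching x₀ (hB (hball (Metric.mem_ball_self hε))) t₀ (hI ht₀) ε hε hZ φ
    (isTestFunction_barrier hr hℓ hβ x₀ t₀ ε) heq fun p hp =>
      hle p.1 (hball hp.1) p.2 (htime p.2 hp.2) ⟨by linarith [hp.2.1], hp.2.2⟩
  have hderiv : HasDerivAt (φ x₀) (ℓ' - β' * bump r x₀) t₀ := hℓ'.sub (hβ'.mul_const _)
  rw [leftDeriv_glue hε hderiv] at htouch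
  set v : Rd d → ℝ := fun x => glue x₀ t₀ ε φ u x t₀ with hv
  set S : Set (Rd d) := {x ∈ Metric.ball (0 : Rd d) r | u x t₀ ≤ c} with hS
  have hvin : ∀ x ∈ Metric.ball x₀ ε, v x = ℓ t₀ - β t₀ * bump r x := fun x =>
    (glue_slice hε φ u).1
  have hvout : ∀ x ∉ Metric.ball x₀ ε, v x = u x t₀ := fun x => (glue_slice hε φ u).2
  have hslice := hu.bounded.aemeasurable_slice t₀ (hI ht₀)
  have hbar : ∀ x : Rd d, 0 ≤ β t₀ * bump r x ∧ β t₀ * bump r x ≤ β t₀ := fun x =>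
    ⟨mul_nonneg hβ0 (bump_nonneg r x), mul_le_of_le_one_right hβ0 (bump_le_one r x)⟩
  -- The gap is `a / 2`: the top level is at least `c + a`, the bump removes at most `a / 2`, and `u
  -- ≤ c` on `S`.
  have htb : TouchesBarrier s r ε (ℓ t₀) (β t₀) N (a / 2) S x₀ v := by
    refine ⟨?_, ?_, hvin, ?_, ?_, ?_, fun x hx => hx.1, ?_⟩
    · exact aemeasurable_of_eq_on_off measurableSet_ball
        (((continuous_bump r).measurable.const_mul (β t₀)).const_sub (ℓ t₀)).aemeasurable
        hslice hvin hvout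
    · obtain ⟨M, hM⟩ := hu.bounded.bounded
      refine ⟨max (|ℓ t₀| + β t₀) M, fun x => ?_⟩
      by_cases hx : x ∈ Metric.ball x₀ ε
      · rw [hvin x hx]
        refine le_max_of_le_left ((abs_sub _ _).trans ?_)
        rw [abs_of_nonneg (hbar x).1]
        linarith [(hbar x).2]
      · rw [hvout x hx]
        exact le_max_of_le_right (hM x t₀ (hI ht₀))
    · intro x hx
      by_cases hx' : x ∈ Metric.ball x₀ ε
      · exact (hvin x hx').le
      · rw [hvout x hx']
        exact hle x hx t₀ ht₀ ⟨by linarith, le_rfl⟩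
    · intro x hx
      rw [hvout x fun h => hx (hball h)]
      linarith [hout x hx]
    · exact measurableSet_ball.nullMeasurableSet.inter
        (nullMeasurableSet_le hslice aemeasurable_const)
    · intro x hx hx'
      rw [hvout x hx']
      have := hx.2
      linarith [(hbar x).2]
  have hp := htb.pucciSup_le hs hs1 hlam hLam hρ hr hρr hε hβ0 hN (by positivity) hx₀ hne hC
  rw [volume_real_ball _ hε] at hp
  have hsmall : Q * (ε ^ d * unitVol d) ≤ e := by
    have h1 : ε ^ d ≤ ε := by
      calc ε ^ d ≤ ε ^ 1 := pow_le_pow_of_le_one hε.le hε1 hd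
        _ = ε := pow_one ε
    calc Q * (ε ^ d * unitVol d) ≤ Q * (ε * unitVol d) := by gcongr
      _ = ε * (Q * unitVol d) := by ring
      _ ≤ e := (le_div_iff₀ (by positivity)).1 hεe
  have hsplit : a / 2 * (lam * (2 * r) ^ (-(d : ℝ) - 2 * s) *
      (volume.real S - ε ^ d * unitVol d)) =
      a / 2 * (lam * (2 * r) ^ (-(d : ℝ) - 2 * s) * volume.real S) -
        Q * (ε ^ d * unitVol d) := by
    rw [hQ]; ring
  rw [hsplit] at hp
  linarith

/-! ### Time weights -/

/-- `g` is an upper semicontinuous minorant of `f` losing at most `η` of the integral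
(Vitali–Carathéodory), and `G` is its primitive from `a`. Upper semicontinuity bounds the increments
of `G` to the left of `t₀` by slope `g t₀ + ε`, a one-sided substitute for differentiability.
Measurability of `f` is not required. -/
theorem exists_time_weight {f : ℝ → NNReal} {a b V η : ℝ} (hab : a ≤ b) (hη : 0 < η)
    (hV : ∀ t, (f t : ℝ) ≤ V) (hsupp : ∀ t ∉ Ioc a b, f t = 0) :
    ∃ G g : ℝ → ℝ, (∀ t, 0 ≤ g t ∧ g t ≤ f t) ∧ Continuous G ∧
      (∀ t, a ≤ t → 0 ≤ G t ∧ G t ≤ V * (t - a)) ∧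
      (∀ t₀ ε : ℝ, 0 < ε → ∃ δ > 0, ∀ t ∈ Ioc (t₀ - δ) t₀,
        G t₀ - (g t₀ + ε) * (t₀ - t) ≤ G t) ∧
      ∀ t, b ≤ t → ∫⁻ τ, (f τ : ENNReal) ≤ ENNReal.ofReal (G t + η) := by
  have hffin : ∫⁻ τ, (f τ : ENNReal) ≠ ⊤ := by
    have h1 : ∫⁻ τ, (f τ : ENNReal) = ∫⁻ τ in Ioc a b, (f τ : ENNReal) := by
      rw [← lintegral_indicator measurableSet_Ioc]
      congr with τ
      by_cases hτ : τ ∈ Ioc a b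
      · simp [hτ]
      · simp [hτ, hsupp τ hτ]
    have h2 : ∫⁻ τ in Ioc a b, (f τ : ENNReal) ≤ ∫⁻ _ in Ioc a b, ENNReal.ofReal V := by
      refine lintegral_mono fun τ => ?_
      rw [← ENNReal.ofReal_coe_nnreal]
      exact ENNReal.ofReal_le_ofReal (hV τ)
    rw [h1]
    refine (h2.trans_lt ?_).ne
    rw [setLIntegral_const, Real.volume_Ioc]
    exact ENNReal.mul_lt_top ENNReal.ofReal_lt_top ENNReal.ofReal_lt_top
  obtain ⟨g, hgf, hgusc, hgint⟩ := exists_upperSemicontinuous_le_lintegral_le f hffin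
    (ENNReal.ofReal_pos.2 hη).ne'
  have hgm : Measurable fun t => (g t : ℝ) := hgusc.measurable.coe_nnreal_real
  have hgi : Integrable fun t => (g t : ℝ) := by
    refine ⟨hgm.aestronglyMeasurable, ?_⟩
    rw [hasFiniteIntegral_iff_ofNNReal]
    exact (lintegral_mono fun τ => ENNReal.coe_le_coe.2 (hgf τ)).trans_lt hffin.lt_top
  have hgV : ∀ t, (g t : ℝ) ≤ V := fun t => le_trans (NNReal.coe_le_coe.2 (hgf t)) (hV t)
  have hgii : ∀ x y : ℝ, IntervalIntegrable (fun t => (g t : ℝ)) volume x y :=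
    fun x y => hgi.intervalIntegrable
  refine ⟨fun t => ∫ τ in a..t, (g τ : ℝ), fun t => g t,
    fun t => ⟨(g t).2, NNReal.coe_le_coe.2 (hgf t)⟩,
    intervalIntegral.continuous_primitive hgii a, fun t ht => ⟨?_, ?_⟩, ?_, fun t ht => ?_⟩
  · exact intervalIntegral.integral_nonneg ht fun τ _ => (g τ).2
  · calc ∫ τ in a..t, (g τ : ℝ) ≤ ∫ _ in a..t, V :=
          intervalIntegral.integral_mono ht (hgii a t) intervalIntegrable_const hgV
      _ = V * (t - a) := by rw [intervalIntegral.integral_const, smul_eq_mul, mul_comm]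
  · intro t₀ ε hε
    have husc : UpperSemicontinuous fun t => (g t : ℝ) :=
      NNReal.continuous_coe.comp_upperSemicontinuous hgusc fun x y h => NNReal.coe_le_coe.2 h
    obtain ⟨δ, hδ, hδg⟩ := Metric.eventually_nhds_iff.1 (husc t₀ ((g t₀ : ℝ) + ε) (by linarith))
    refine ⟨δ, hδ, fun t ht => ?_⟩
    have h1 : (∫ τ in a..t₀, (g τ : ℝ)) - ∫ τ in a..t, (g τ : ℝ) = ∫ τ in t..t₀, (g τ : ℝ) :=
      intervalIntegral.integral_interval_sub_left (hgii a t₀) (hgii a t)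
    have h2 : ∫ τ in t..t₀, (g τ : ℝ) ≤ ∫ _ in t..t₀, ((g t₀ : ℝ) + ε) := by
      refine intervalIntegral.integral_mono_on ht.2 (hgii t t₀) intervalIntegrable_const
        fun τ hτ => (hδg ?_).le
      rw [Real.dist_eq, abs_lt]
      constructor <;> linarith [hτ.1, hτ.2, ht.1]
    rw [intervalIntegral.integral_const, smul_eq_mul] at h2
    simp only
    linarith
  · have hat : a ≤ t := hab.trans ht
    have h1 : ∫ τ in a..t, (g τ : ℝ) = ∫ τ, (g τ : ℝ) := by
      rw [intervalIntegral.integral_of_le hat]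
      refine setIntegral_eq_integral_of_forall_compl_eq_zero fun τ hτ => ?_
      have h2 : f τ = 0 := hsupp τ fun h => hτ ⟨h.1, h.2.trans ht⟩
      have h3 := hgf τ
      rw [h2] at h3
      simp [nonpos_iff_eq_zero.1 h3]
    simp only [h1]
    have h0 : 0 ≤ ∫ τ, (g τ : ℝ) := integral_nonneg fun τ => (g τ).2
    rw [ENNReal.ofReal_add h0 hη.le,
      ofReal_integral_eq_lintegral_ofReal hgi (Filter.Eventually.of_forall fun τ => (g τ).2)]
    simpa using hgint

theorem IsBoundedOn.nullMeasurableSet_inter {I : Set ℝ} {u : Rd d → ℝ → ℝ} (hu : IsBoundedOn I u)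
    (hI : MeasurableSet I) {P : Set (Rd d × ℝ)} (hP : MeasurableSet P) (hPI : P ⊆ univ ×ˢ I)
    (c : ℝ) : NullMeasurableSet (P ∩ {p | u p.1 p.2 ≤ c}) volume := by
  have h : NullMeasurableSet {p : Rd d × ℝ | u p.1 p.2 ≤ c} (volume.restrict (univ ×ˢ I)) :=
    nullMeasurableSet_le hu.aemeasurable aemeasurable_const
  have h2 := (nullMeasurableSet_restrict (MeasurableSet.univ.prod hI).nullMeasurableSet).1 h
  have h3 := h2.inter hP.nullMeasurableSet
  have heq : P ∩ {p | u p.1 p.2 ≤ c} = {p | u p.1 p.2 ≤ c} ∩ univ ×ˢ I ∩ P :=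
    Set.ext fun p => ⟨fun hp => ⟨⟨hp.2, hPI hp.1⟩, hp.1⟩, fun hp => ⟨hp.2, hp.1.1⟩⟩
  rw [heq]
  exact h3

/-- The part of the measure of a sublevel set is controlled by the measures of its time slices. -/
theorem IsBoundedOn.volume_inter_le {I J : Set ℝ} {u : Rd d → ℝ → ℝ} (hu : IsBoundedOn I u)
    (hI : MeasurableSet I) (hJ : MeasurableSet J) (hJI : J ⊆ I) (r c : ℝ) :
    volume ((Metric.ball (0 : Rd d) r ×ˢ J) ∩ {p | u p.1 p.2 ≤ c}) ≤
      ∫⁻ t, J.indicator (fun t => volume {x ∈ Metric.ball (0 : Rd d) r | u x t ≤ c}) t := by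
  -- Fubini is applied to a measurable subset of full measure. Its slices are contained in the
  -- actual slices, so the inequality goes the right way at every time.
  obtain ⟨S, hS, hSm, hSae⟩ := (hu.nullMeasurableSet_inter hI (measurableSet_ball.prod hJ)
    (fun p hp => ⟨mem_univ _, hJI hp.2⟩) c).exists_measurable_subset_ae_eq
  rw [← measure_congr hSae, Measure.volume_eq_prod, Measure.prod_apply_symm hSm]
  refine lintegral_mono fun t => ?_
  by_cases ht : t ∈ J
  · rw [indicator_of_mem ht]
    exact measure_mono fun x hx => ⟨(hS hx).1.1, (hS hx).2⟩
  · rw [indicator_of_notMem ht]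
    have hempty : (fun x : Rd d => (x, t)) ⁻¹' S = ∅ :=
      eq_empty_of_forall_notMem fun x hx => ht (hS hx).1.2
    rw [hempty, measure_empty]

/-! ### The growth lemma -/

/-- The part of the cylinder of radius `r` in which sublevel sets are measured. -/
def pastInterval (s r : ℝ) : Set ℝ := Ioc (-((2 * r) ^ (2 * s))) (-((r / 2) ^ (2 * s)))

theorem pastInterval_subset {s r : ℝ} (hr : 0 < r) : pastInterval s r ⊆ timeInterval s (2 * r) :=
  Ioc_subset_Ioc_right (neg_nonpos.2 (by positivity))

/-- The accumulated measure of the sublevel sets in the past of the cylinder, regularized so that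
it can be used in a test function. -/
theorem IsBoundedOn.exists_sublevel_weight {s r R : ℝ} {u : Rd d → ℝ → ℝ}
    (hu : IsBoundedOn (timeInterval s R) u) (hs : 0 < s) (hr : 0 < r) (hrR : 2 * r ≤ R) (c : ℝ)
    (hmeas : volume (Metric.ball (0 : Rd d) r ×ˢ pastInterval s r) ≤
      2 * volume ((Metric.ball (0 : Rd d) r ×ˢ pastInterval s r) ∩ {p | u p.1 p.2 ≤ c})) :
    ∃ G g : ℝ → ℝ,
      (∀ t, 0 ≤ g t ∧ g t ≤ volume.real {x ∈ Metric.ball (0 : Rd d) r | u x t ≤ c}) ∧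
      Continuous G ∧
      (∀ t, -((2 * r) ^ (2 * s)) ≤ t →
        0 ≤ G t ∧ G t ≤ r ^ d * unitVol d * (t + (2 * r) ^ (2 * s))) ∧
      (∀ t₀ ε : ℝ, 0 < ε → ∃ δ > 0, ∀ t ∈ Ioc (t₀ - δ) t₀,
        G t₀ - (g t₀ + ε) * (t₀ - t) ≤ G t) ∧
      ∀ t, -((r / 2) ^ (2 * s)) ≤ t →
        r ^ d * unitVol d * ((2 * r) ^ (2 * s) - (r / 2) ^ (2 * s)) / 4 ≤ G t := by
  set T := (2 * r) ^ (2 * s) with hT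
  set T₁ := (r / 2) ^ (2 * s) with hT₁
  set J := pastInterval s r with hJ
  set V := r ^ d * unitVol d with hV
  have hω := unitVol_pos d
  have hV0 : 0 < V := by positivity
  have hTT : T₁ < T := Real.rpow_lt_rpow (by positivity) (by linarith) (by linarith)
  set S : ℝ → Set (Rd d) := fun t => {x ∈ Metric.ball (0 : Rd d) r | u x t ≤ c} with hS
  have hSV : ∀ t, volume.real (S t) ≤ V := fun t => by
    rw [hV, ← volume_real_ball (0 : Rd d) hr]
    exact measureReal_mono (fun x hx => hx.1) measure_ball_lt_top.ne
  have hSfin : ∀ t, volume (S t) ≠ ⊤ := fun t =>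
    ((measure_mono fun x hx => hx.1).trans_lt (measure_ball_lt_top (x := (0 : Rd d)) (r := r))).ne
  set f : ℝ → NNReal := J.indicator fun t => (volume (S t)).toNNReal with hf
  have hfS : ∀ t, (f t : ℝ) ≤ volume.real (S t) := fun t => by
    by_cases ht : t ∈ J
    · rw [hf, indicator_of_mem ht]; rfl
    · rw [hf, indicator_of_notMem ht]; exact measureReal_nonneg
  -- The hypothesis supplies half of the measure of the past cylinder. Giving up a quarter to the
  -- regularization leaves a quarter as the lower bound for `G`.
  have hη : 0 < V * (T - T₁) / 4 := by
    have : 0 < T - T₁ := by linarith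
    positivity
  obtain ⟨G, g, hg, hGc, hGb, hGs, hGm⟩ := exists_time_weight (f := f) (a := -T) (b := -T₁)
    (V := V) (by linarith) hη (fun t => (hfS t).trans (hSV t))
    fun t ht => indicator_of_notMem ht _
  refine ⟨G, g, fun t => ⟨(hg t).1, (hg t).2.trans (hfS t)⟩, hGc, fun t ht => ?_, hGs,
    fun t ht => ?_⟩
  · simpa using hGb t ht
  · have h1 := hu.volume_inter_le (d := d) measurableSet_Ioc (J := J) measurableSet_Ioc
      ((pastInterval_subset hr).trans (timeInterval_mono hs (by positivity) hrR)) r c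
    have h2 : ∫⁻ t, J.indicator (fun t => volume {x ∈ Metric.ball (0 : Rd d) r | u x t ≤ c}) t =
        ∫⁻ t, (f t : ENNReal) := by
      congr with t
      by_cases ht : t ∈ J
      · rw [hf, indicator_of_mem ht, indicator_of_mem ht, ENNReal.coe_toNNReal (hSfin t)]
      · rw [hf, indicator_of_notMem ht, indicator_of_notMem ht, ENNReal.coe_zero]
    have h3 : volume (Metric.ball (0 : Rd d) r ×ˢ J) = ENNReal.ofReal (V * (T - T₁)) := by
      rw [Measure.volume_eq_prod, Measure.prod_prod, hJ, pastInterval, Real.volume_Ioc,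
        ← ENNReal.ofReal_toReal (measure_ball_lt_top (x := (0 : Rd d)) (r := r)).ne,
        ← Measure.real, volume_real_ball _ hr, ← ENNReal.ofReal_mul hV0.le]
      congr 2
      ring
    have h4 : ENNReal.ofReal (V * (T - T₁)) ≤
        ENNReal.ofReal (2 * (G t + V * (T - T₁) / 4)) := by
      rw [← h3, ENNReal.ofReal_mul (by norm_num), ENNReal.ofReal_ofNat]
      refine hmeas.trans (mul_le_mul_right ?_ 2)
      exact (h1.trans_eq h2).trans (hGm t ht)
    have h5 := (ENNReal.ofReal_le_ofReal_iff (by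
      have := (hGb t (by linarith)).1
      positivity)).1 h4
    linarith

set_option maxHeartbeats 1000000 in
/-- A subsolution which lies below `c` on half of the past cylinder is strictly improved at later
times, if it does not grow too much at infinity. -/
theorem growth_lemma (hd : 1 ≤ d) {s lam Lam b₀ : ℝ} (hs : 0 < s) (hs1 : s < 1)
    (hlam : 0 < lam) (hLam : 0 < Lam) (hb₀ : 0 ≤ b₀) :
    ∃ θ τ : ℝ, 0 < θ ∧ θ ≤ 1 / 2 ∧ 0 < τ ∧
      ∀ (ρ r R b A a c : ℝ) (u : Rd d → ℝ → ℝ), 0 ≤ ρ → 0 < r → ρ ≤ 2 * r → 2 * r ≤ R →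
        b * r ^ (2 * s - 1) ≤ b₀ → (kernelClass d s lam Lam ρ).Nonempty →
        IsViscositySubsolution (fun w x => b * ‖gradient w x‖ + pucciSup s lam Lam ρ w x)
          (fun _ _ => A) (Metric.ball 0 R) (timeInterval s R) u →
        0 < a → A ≤ τ * a * r ^ (-(2 * s)) →
        (∀ x ∈ Metric.ball (0 : Rd d) (2 * r), ∀ t ∈ timeInterval s (2 * r), u x t ≤ c + a) →
        (∀ x ∉ Metric.ball (0 : Rd d) (2 * r), ∀ t ∈ timeInterval s (2 * r),
          u x t ≤ c + a + a * τ * (‖x‖ / r) ^ s) →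
        volume (Metric.ball (0 : Rd d) r ×ˢ pastInterval s r) ≤
          2 * volume ((Metric.ball (0 : Rd d) r ×ˢ pastInterval s r) ∩ {p | u p.1 p.2 ≤ c}) →
        ∀ x ∈ Metric.ball (0 : Rd d) (r / 2), ∀ t ∈ timeInterval s (r / 2),
          u x t ≤ c + a * (1 - θ) := by
  obtain ⟨C, hC0, hC⟩ := exists_bump_bound hd hs hs1 hlam hLam hb₀
  have hω := unitVol_pos d
  have htc := tailConst_pos hs hLam
  set ω := unitVol d with hωdef
  set T₂ : ℝ := 2 ^ (2 * s) with hT₂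
  set T₃ : ℝ := (1 / 2) ^ (2 * s) with hT₃
  have hT₂0 : 0 < T₂ := by positivity
  have hT₃₂ : T₃ < T₂ := Real.rpow_lt_rpow (by norm_num) (by norm_num) (by linarith)
  -- The first bound lets the gain from the sublevel set dominate the growth of `m`; the second
  -- keeps `m ≤ 1 / 2`, hence the gap `a / 2`.
  set κ : ℝ := min (lam * 2 ^ (-(d : ℝ) - 2 * s) / 2) (1 / (2 * ω * T₂)) with hκ
  have hκ0 : 0 < κ := by positivity
  have hκ1 : κ ≤ lam * 2 ^ (-(d : ℝ) - 2 * s) / 2 := min_le_left _ _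
  have hκ2 : κ * (ω * T₂) ≤ 1 / 2 := by
    have : κ ≤ 1 / (2 * ω * T₂) := min_le_right _ _
    rw [le_div_iff₀ (by positivity)] at this
    linarith
  -- At late times in `B_{r/2}` the bump term will be at least `3 * θ`: two `θ` cancel the
  -- increasing corrections in `Ψ`, and one is the improvement.
  set θ : ℝ := min (κ * Real.exp (-(C * T₂)) * (ω * (T₂ - T₃) / 4) * (9 / 16) / 3) (1 / 2) with hθ
  have hT₂₃ : 0 < T₂ - T₃ := by linarith
  have hθ0 : 0 < θ := by positivity
  have hθ1 : 3 * θ ≤ κ * Real.exp (-(C * T₂)) * (ω * (T₂ - T₃) / 4) * (9 / 16) := by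
    have : θ ≤ κ * Real.exp (-(C * T₂)) * (ω * (T₂ - T₃) / 4) * (9 / 16) / 3 := min_le_left _ _
    linarith
  -- With this `τ`, the right-hand side and the tail together use up a quarter of the slope `θ / T`
  -- of the barrier.
  set τ : ℝ := θ / (4 * T₂ * (1 + tailConst s Lam)) with hτ
  have hτ0 : 0 < τ := by positivity
  refine ⟨θ, τ, hθ0, min_le_right _ _, hτ0, ?_⟩
  intro ρ r R b A a c u hρ hr hρr hrR hb hne hu ha hA hin hout hmeas
  obtain ⟨G, g, hg, hGc, hGb, hGs, hGm⟩ := hu.bounded.exists_sublevel_weight hs hr hrR c hmeas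
  set T := (2 * r) ^ (2 * s) with hT
  set q := r ^ (-(2 * s)) with hq
  set p := r ^ (-(d : ℝ) - 2 * s) with hp
  have hq0 : 0 < q := by positivity
  have hp0 : 0 < p := by positivity
  have hT0 : 0 < T := by positivity
  have hqr : q * r ^ (2 * s) = 1 := by
    rw [hq, ← Real.rpow_add hr, neg_add_cancel, Real.rpow_zero]
  have hqT : q * T = T₂ := by
    rw [hT, Real.mul_rpow (by norm_num) hr.le, ← hT₂]
    linear_combination T₂ * hqr
  have hT1 : (r / 2) ^ (2 * s) = T₃ * r ^ (2 * s) := by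
    rw [hT₃, ← Real.mul_rpow (by norm_num) hr.le]; ring_nf
  have hpq : p * r ^ d = q := by
    rw [hp, hq, ← Real.rpow_natCast, ← Real.rpow_add hr]; ring_nf
  have hp2 : (2 * r) ^ (-(d : ℝ) - 2 * s) = 2 ^ (-(d : ℝ) - 2 * s) * p :=
    Real.mul_rpow (by norm_num) hr.le
  set e : ℝ → ℝ := fun t => Real.exp (-(C * q * (t + T))) with he
  have he0 : ∀ t, 0 < e t := fun t => Real.exp_pos _
  have he1 : ∀ t, -T ≤ t → e t ≤ 1 := fun t ht => by
    rw [he, Real.exp_le_one_iff, neg_nonpos]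
    have : 0 ≤ t + T := by linarith
    positivity
  set m : ℝ → ℝ := fun t => κ * p * e t * G t with hm
  have hm0 : ∀ t, -T ≤ t → 0 ≤ m t := fun t ht =>
    mul_nonneg (mul_nonneg (by positivity) (he0 t).le) (hGb t ht).1
  have hm1 : ∀ t, -T ≤ t → m t ≤ κ * ω * q * (t + T) := fun t ht => by
    calc m t ≤ κ * p * 1 * (r ^ d * ω * (t + T)) := by
          refine mul_le_mul (mul_le_mul_of_nonneg_left (he1 t ht) (by positivity)) (hGb t ht).2
            (hGb t ht).1 (by positivity)
      _ = κ * ω * q * (t + T) := by rw [← hpq]; ring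
  have hm2 : ∀ t ∈ timeInterval s (2 * r), m t ≤ 1 / 2 := fun t ht => by
    calc m t ≤ κ * ω * q * (t + T) := hm1 t ht.1.le
      _ ≤ κ * ω * q * T := mul_le_mul_of_nonneg_left (by linarith [ht.2]) (by positivity)
      _ = κ * (ω * T₂) := by rw [← hqT]; ring
      _ ≤ 1 / 2 := hκ2
  have hcm : Continuous m := by
    rw [hm, he]; fun_prop
  -- The linear term gives the barrier a strictly positive slope in time. The final `θ` places it
  -- above `c + a` wherever the bump term is at most `θ`, which keeps the contact set away from the
  -- parabolic boundary.
  set Ψ : Rd d → ℝ → ℝ := fun x t => c + a * (1 - m t * bump r x + θ * ((t + T) / T) + θ) with hΨ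
  intro x₁ hx₁ t₁ ht₁
  by_contra! hcon
  have hx₁' : x₁ ∈ Metric.ball (0 : Rd d) (2 * r) := Metric.ball_subset_ball (by linarith) hx₁
  have ht₁' : t₁ ∈ timeInterval s (2 * r) :=
    timeInterval_mono hs (by positivity) (by linarith) ht₁
  have hF1 : 0 < u x₁ t₁ - Ψ x₁ t₁ := by
    have h1 : Real.exp (-(C * T₂)) ≤ e t₁ := by
      rw [he, Real.exp_le_exp, neg_le_neg_iff, mul_assoc, ← hqT]
      gcongr
      linarith [ht₁.2]
    have h2 := hGm t₁ ht₁.1.le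
    have h3 : 9 / 16 ≤ bump r x₁ := le_bump hr (by simpa using (mem_ball_zero_iff.1 hx₁).le)
    have h4 : r ^ d * ω * (T - (r / 2) ^ (2 * s)) / 4 * p = ω * (T₂ - T₃) / 4 := by
      calc r ^ d * ω * (T - (r / 2) ^ (2 * s)) / 4 * p
          = ω * (q * T - T₃ * (q * r ^ (2 * s))) / 4 := by rw [hT1, ← hpq]; ring
        _ = ω * (T₂ - T₃) / 4 := by rw [hqT, hqr, mul_one]
    have h5 : 3 * θ ≤ m t₁ * bump r x₁ := by
      calc 3 * θ ≤ κ * Real.exp (-(C * T₂)) * (ω * (T₂ - T₃) / 4) * (9 / 16) := hθ1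
        _ ≤ κ * e t₁ * (G t₁ * p) * bump r x₁ := by
            rw [← h4]
            have h6 : 0 ≤ r ^ d * ω * (T - (r / 2) ^ (2 * s)) / 4 * p := by
              rw [h4]; positivity
            have h7 : 0 < κ * e t₁ := mul_pos hκ0 (he0 t₁)
            have h8 : r ^ d * ω * (T - (r / 2) ^ (2 * s)) / 4 * p ≤ G t₁ * p :=
              mul_le_mul_of_nonneg_right h2 hp0.le
            refine mul_le_mul (mul_le_mul (mul_le_mul_of_nonneg_left h1 hκ0.le) h8 h6 h7.le) h3
              (by norm_num) (mul_nonneg h7.le (h6.trans h8))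
        _ = m t₁ * bump r x₁ := by rw [hm]; ring
    have h6 : (t₁ + T) / T ≤ 1 := by rw [div_le_one hT0]; linarith [ht₁.2]
    have h7 : θ * ((t₁ + T) / T) ≤ θ := mul_le_of_le_one_right hθ0.le h6
    have h8 : a * (1 - m t₁ * bump r x₁ + θ * ((t₁ + T) / T) + θ) ≤ a * (1 - θ) :=
      mul_le_mul_of_nonneg_left (by linarith) ha.le
    simp only [hΨ]
    linarith
  -- Up to time `-T + τ'` the bound `m t ≤ κ * ω * q * (t + T)` gives `m t ≤ θ`, so no contact
  -- happens there. A closed time interval, hence a compact set, therefore suffices for the maximum.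
  set τ' : ℝ := θ / (κ * ω * q) with hτ'
  have hτ'0 : 0 < τ' := by positivity
  have hpos : ∀ x ∈ Metric.ball (0 : Rd d) (2 * r), ∀ t ∈ timeInterval s (2 * r),
      0 < u x t - Ψ x t → ‖x‖ < r ∧ -T + τ' ≤ t := by
    intro x hx t ht hF
    have h1 : 0 ≤ θ * ((t + T) / T) :=
      mul_nonneg hθ0.le (div_nonneg (by linarith [ht.1]) hT0.le)
    have h2 : θ < m t * bump r x := by
      by_contra! h
      have h3 : a * 1 ≤ a * (1 - m t * bump r x + θ * ((t + T) / T) + θ) :=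
        mul_le_mul_of_nonneg_left (by linarith) ha.le
      have h4 := hin x hx t ht
      simp only [hΨ] at hF
      linarith
    constructor
    · by_contra! h
      rw [bump_eq_zero hr h, mul_zero] at h2
      linarith
    · have h3 : m t * bump r x ≤ m t := mul_le_of_le_one_right (hm0 t ht.1.le) (bump_le_one r x)
      have h4 := hm1 t ht.1.le
      have h5 : τ' ≤ t + T := by
        rw [hτ', div_le_iff₀ (by positivity)]
        linarith
      linarith
  set Kc : Set (Rd d × ℝ) := Metric.closedBall 0 r ×ˢ Icc (-T + τ') 0 with hKc
  have hKcompact : IsCompact Kc := (isCompact_closedBall 0 r).prod isCompact_Icc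
  have hKsub : ∀ z ∈ Kc, z.1 ∈ Metric.ball (0 : Rd d) (2 * r) ∧ z.2 ∈ timeInterval s (2 * r) :=
    fun z hz => ⟨Metric.closedBall_subset_ball (by linarith) hz.1,
      ⟨by linarith [hz.2.1], hz.2.2⟩⟩
  have hposK : ∀ x ∈ Metric.ball (0 : Rd d) (2 * r), ∀ t ∈ timeInterval s (2 * r),
      0 < u x t - Ψ x t → (x, t) ∈ Kc := fun x hx t ht hF => by
    obtain ⟨h1, h2⟩ := hpos x hx t ht hF
    exact ⟨mem_closedBall_zero_iff.2 h1.le, h2, ht.2⟩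
  have hI := timeInterval_mono hs (by positivity) hrR
  have hΨc : Continuous fun z : Rd d × ℝ => -Ψ z.1 z.2 := by
    have := continuous_bump (d := d) r
    simp only [hΨ]
    fun_prop
  have husc : UpperSemicontinuousOn (fun z : Rd d × ℝ => Function.uncurry u z + -Ψ z.1 z.2) Kc :=
    (hu.semicontinuous.mono fun z hz =>
      ⟨Metric.ball_subset_ball hrR (hKsub z hz).1, hI (hKsub z hz).2⟩).add
      hΨc.continuousOn.upperSemicontinuousOn
  obtain ⟨⟨x₀, t₀⟩, hz₀, hmax⟩ := husc.exists_isMaxOn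
    ⟨(x₁, t₁), hposK x₁ hx₁' t₁ ht₁' hF1⟩ hKcompact
  have hmax' : ∀ z ∈ Kc, u z.1 z.2 - Ψ z.1 z.2 ≤ u x₀ t₀ - Ψ x₀ t₀ := fun z hz => by
    simpa [sub_eq_add_neg, Function.uncurry] using isMaxOn_iff.1 hmax z hz
  set W := u x₀ t₀ - Ψ x₀ t₀ with hW
  have hW0 : 0 < W := hF1.trans_le (hmax' _ (hposK x₁ hx₁' t₁ ht₁' hF1))
  have hglobal : ∀ x ∈ Metric.ball (0 : Rd d) (2 * r), ∀ t ∈ timeInterval s (2 * r),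
      u x t ≤ Ψ x t + W := fun x hx t ht => by
    by_cases hF : 0 < u x t - Ψ x t
    · linarith [hmax' _ (hposK x hx t ht hF)]
    · linarith
  obtain ⟨hx₀, ht₀⟩ := hKsub _ hz₀
  simp only at hx₀ ht₀
  have hx₀r := (hpos x₀ hx₀ t₀ ht₀ hW0).1
  -- The slope error in the linear minorant of `G` uses up another quarter of `θ / T`.
  set ε₁ : ℝ := θ / (4 * T * κ * p) with hε₁
  have hε₁0 : 0 < ε₁ := by positivity
  obtain ⟨δ, hδ, hδG⟩ := hGs t₀ ε₁ hε₁0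
  set ℓ : ℝ → ℝ := fun t => c + a * (1 + θ * ((t + T) / T) + θ) + W with hℓ
  -- `m` need not be differentiable, so `G` is replaced by its linear minorant to the left of `t₀`.
  -- A smaller bump coefficient raises the test function, which thus still lies above `u` and agrees
  -- with it at the contact point.
  set β : ℝ → ℝ := fun t => a * (κ * p * e t * (G t₀ - (g t₀ + ε₁) * (t₀ - t))) with hβ
  have hℓ' : ∀ t, HasDerivAt ℓ (a * (θ * (1 / T))) t := fun t => by
    have h := ((((((hasDerivAt_id t).add_const T).div_const T).const_mul θ).const_add 1).add_const
      θ).const_mul a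
    exact (h.const_add c).add_const W
  have hβ' : ∀ t, HasDerivAt β (a * (κ * p * (e t * (-(C * q * 1))) *
      (G t₀ - (g t₀ + ε₁) * (t₀ - t)) + κ * p * e t * (-((g t₀ + ε₁) * (-1))))) t := fun t => by
    have h1 : HasDerivAt e (e t * (-(C * q * 1))) t :=
      ((((hasDerivAt_id t).add_const T).const_mul (C * q)).neg).exp
    have h2 : HasDerivAt (fun t => G t₀ - (g t₀ + ε₁) * (t₀ - t)) (-((g t₀ + ε₁) * (-1))) t :=
      (((hasDerivAt_id t).const_sub t₀).const_mul (g t₀ + ε₁)).const_sub (G t₀)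
    exact ((h1.const_mul (κ * p)).mul h2).const_mul a
  have hβt₀ : β t₀ = a * m t₀ := by simp only [hβ, hm]; ring
  have hkey := hu.barrier_inequality hd hs hs1 hlam hLam hρ hr hρr hrR hne (c := c) ha
    (mul_pos ha hτ0).le hx₀r ht₀ (fun K hK => hC ρ r b K x₀ hρ hr hρr hK hb hx₀r)
    (fun x hx => hout x hx t₀ ht₀) (fun t => (hℓ' t).differentiableAt)
    (fun t => (hβ' t).differentiableAt) (hℓ' t₀) (hβ' t₀)
    (by rw [hβt₀]; exact mul_nonneg ha.le (hm0 t₀ ht₀.1.le))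
    (by rw [hβt₀]; nlinarith [hm2 t₀ ht₀])
    (by
      have h1 : 0 ≤ θ * ((t₀ + T) / T) :=
        mul_nonneg hθ0.le (div_nonneg (by linarith [ht₀.1]) hT0.le)
      have h2 : a * 1 ≤ a * (1 + θ * ((t₀ + T) / T) + θ) :=
        mul_le_mul_of_nonneg_left (by linarith) ha.le
      simp only [hℓ]
      linarith)
    hδ
    (by
      rw [hβt₀]
      simp only [hℓ, hW, hΨ]
      ring)
    (fun x hx t ht htδ => by
      refine (hglobal x hx t ht).trans ?_
      have h1 : β t ≤ a * m t := by
        simp only [hβ, hm]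
        have := (mul_pos (mul_pos hκ0 hp0) (he0 t)).le
        exact mul_le_mul_of_nonneg_left (mul_le_mul_of_nonneg_left (hδG t htδ) this) ha.le
      have h2 := mul_le_mul_of_nonneg_right h1 (bump_nonneg r x)
      simp only [hΨ, hℓ]
      linarith)
  rw [← hq, hp2] at hkey
  have hgS := (hg t₀).2
  have hg0 := (hg t₀).1
  set Sv := volume.real {x ∈ Metric.ball (0 : Rd d) r | u x t₀ ≤ c} with hSv
  have hb0 := bump_nonneg r x₀
  have hb1 := bump_le_one r x₀
  have hE0 := he0 t₀
  have hE1 := he1 t₀ ht₀.1.le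
  have f1 : κ * p * e t₀ * (g t₀ + ε₁) * bump r x₀ ≤ κ * p * (g t₀ + ε₁) := by
    have h1 : e t₀ * bump r x₀ ≤ 1 := by nlinarith
    have h2 : 0 ≤ κ * p * (g t₀ + ε₁) := by positivity
    nlinarith
  have f2 : κ * p * g t₀ ≤ 1 / 2 * (lam * (2 ^ (-(d : ℝ) - 2 * s) * p) * Sv) := by
    calc κ * p * g t₀ ≤ lam * 2 ^ (-(d : ℝ) - 2 * s) / 2 * p * Sv := by gcongr
      _ = _ := by ring
  have f3 : κ * p * ε₁ = θ * (1 / T) / 4 := by rw [hε₁]; field_simp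
  have f4 : τ * q + τ * tailConst s Lam * q = θ * (1 / T) / 4 := by
    rw [hτ, ← hqT]; field_simp
  have f5 : 0 < θ * (1 / T) := by positivity
  have f6 : β t₀ = a * (κ * p * e t₀ * G t₀) := hβt₀
  rw [f6] at hkey
  -- The derivative of the exponential cancels the zeroth order term with constant `C` exactly. What
  -- remains bounds `θ / T` by two quarters of itself, a contradiction.
  have f7 : a * (θ * (1 / T)) ≤ a * (τ * q + τ * tailConst s Lam * q + κ * p * (g t₀ + ε₁) -
      1 / 2 * (lam * (2 ^ (-(d : ℝ) - 2 * s) * p) * Sv)) := by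
    have f8 := mul_le_mul_of_nonneg_left f1 ha.le
    have : a * (κ * p * (e t₀ * (-(C * q * 1))) * (G t₀ - (g t₀ + ε₁) * (t₀ - t₀)) +
        κ * p * e t₀ * (-((g t₀ + ε₁) * (-1)))) * bump r x₀ =
        a * (κ * p * e t₀ * (g t₀ + ε₁) * bump r x₀) -
        a * (κ * p * e t₀ * G t₀) * (C * q * bump r x₀) := by ring
    rw [this] at hkey
    linarith
  have f9 := le_of_mul_le_mul_left f7 ha
  linarith

/-! ### Reflection -/

theorem gradient_neg (w : Rd d → ℝ) (x : Rd d) :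
    gradient (fun y => -w y) x = -gradient w x := by
  simp only [gradient]
  rw [show (fun y => -w y) = -w from rfl, fderiv_neg, map_neg]

theorem diffOp_neg (s : ℝ) (y : Rd d) (w : Rd d → ℝ) (x : Rd d) :
    diffOp s y (fun z => -w z) x = -diffOp s y w x := by
  simp only [diffOp, gradient_neg, inner_neg_right]
  split_ifs
  · ring
  · by_cases hy : y ∈ Metric.ball (0 : Rd d) 1
    · simp only [indicator_of_mem hy]; ring
    · simp only [indicator_of_notMem hy]; ring
  · ring

theorem linearOp_neg (s : ℝ) (K w : Rd d → ℝ) (x : Rd d) :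
    linearOp s K (fun z => -w z) x = -linearOp s K w x := by
  simp only [linearOp, diffOp_neg, neg_mul, integral_neg]

/-- Negation exchanges the real supremum and infimum unconditionally, so finiteness of the extremal
operators plays no role. -/
theorem pucciInf_neg (s lam Lam ρ : ℝ) (w : Rd d → ℝ) (x : Rd d) :
    pucciInf s lam Lam ρ (fun z => -w z) x = -pucciSup s lam Lam ρ w x := by
  rw [pucciInf, pucciSup, ← Real.sInf_neg]
  congr 1
  ext z
  simp only [mem_image, Set.mem_neg, linearOp_neg]
  exact exists_congr fun K => and_congr_right fun _ => neg_eq_iff_eq_neg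

theorem glue_neg (x₀ : Rd d) (t₀ ε : ℝ) (φ u : Rd d → ℝ → ℝ) (x : Rd d) (t : ℝ) :
    glue x₀ t₀ ε (fun x t => -φ x t) u x t = -glue x₀ t₀ ε φ (fun x t => -u x t) x t := by
  unfold glue
  split_ifs <;> simp

theorem IsTestFunction.neg {x₀ : Rd d} {t₀ ε : ℝ} {φ : Rd d → ℝ → ℝ}
    (hφ : IsTestFunction x₀ t₀ ε φ) : IsTestFunction x₀ t₀ ε fun x t => -φ x t where
  time x hx t ht := (hφ.time x hx t ht).neg
  space t ht := by
    obtain ⟨h1, L, hL⟩ := hφ.space t ht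
    refine ⟨h1.neg, L, ?_⟩
    rw [show gradient (fun x => -φ x t) = fun x => -gradient (fun x => φ x t) x from
      funext fun x => gradient_neg _ x]
    exact hL.neg

theorem IsBoundedOn.neg {I : Set ℝ} {u : Rd d → ℝ → ℝ} (hu : IsBoundedOn I u) :
    IsBoundedOn I fun x t => -u x t where
  bounded := by simpa only [abs_neg] using hu.bounded
  aemeasurable := hu.aemeasurable.neg
  aemeasurable_slice t ht := (hu.aemeasurable_slice t ht).neg

/-- This makes the growth lemma, proved for subsolutions only, available from below with the same
constants. -/
theorem IsViscositySupersolution.neg {s lam Lam ρ b A : ℝ} {Ω : Set (Rd d)} {I : Set ℝ}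
    {u : Rd d → ℝ → ℝ}
    (hu : IsViscositySupersolution (fun w x => -(b * ‖gradient w x‖) + pucciInf s lam Lam ρ w x)
      (fun _ _ => -A) Ω I u) :
    IsViscositySubsolution (fun w x => b * ‖gradient w x‖ + pucciSup s lam Lam ρ w x)
      (fun _ _ => A) Ω I fun x t => -u x t where
  bounded := hu.bounded.neg
  semicontinuous := by
    have h := hu.semicontinuous
    intro p hp y hy
    filter_upwards [h p hp (-y) (by simp only [Function.uncurry] at hy ⊢; linarith)] with z hz
    simp only [Function.uncurry] at hz ⊢
    linarith
  touching x₀ hx₀ t₀ ht₀ ε hε hZ φ hφ heq hle := by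
    have h := hu.touching x₀ hx₀ t₀ ht₀ ε hε hZ (fun x t => -φ x t) hφ.neg
      (by linarith) fun p hp => by have := hle p hp; linarith
    simp only [glue_neg, gradient_neg, norm_neg, pucciInf_neg] at h
    have h2 : leftDeriv (glue x₀ t₀ ε (fun x t => -φ x t) u x₀) t₀ =
        -leftDeriv (glue x₀ t₀ ε φ (fun x t => -u x t) x₀) t₀ := by
      rw [show glue x₀ t₀ ε (fun x t => -φ x t) u x₀ =
        -glue x₀ t₀ ε φ (fun x t => -u x t) x₀ from funext fun t => glue_neg x₀ t₀ ε φ u x₀ t]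
      exact derivWithin.neg
    rw [h2] at h
    linarith

/-! ### Decay of oscillation -/

/-- A solution of the extremal inequalities is strictly improved, from above or from below, in the
smaller cylinder. -/
theorem oscillation_dichotomy (hd : 1 ≤ d) {s lam Lam b₀ : ℝ} (hs : 0 < s) (hs1 : s < 1)
    (hlam : 0 < lam) (hLam : 0 < Lam) (hb₀ : 0 ≤ b₀) :
    ∃ θ τ : ℝ, 0 < θ ∧ θ ≤ 1 / 2 ∧ 0 < τ ∧
      ∀ (ρ r R b A a c : ℝ) (u : Rd d → ℝ → ℝ), 0 ≤ ρ → 0 < r → ρ ≤ 2 * r → 2 * r ≤ R →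
        b * r ^ (2 * s - 1) ≤ b₀ → (kernelClass d s lam Lam ρ).Nonempty →
        SolvesExtremalInequalities s lam Lam ρ b A R u →
        0 < a → A ≤ τ * a * r ^ (-(2 * s)) →
        (∀ x ∈ Metric.ball (0 : Rd d) (2 * r), ∀ t ∈ timeInterval s (2 * r), |u x t - c| ≤ a) →
        (∀ x ∉ Metric.ball (0 : Rd d) (2 * r), ∀ t ∈ timeInterval s (2 * r),
          |u x t - c| ≤ a + a * τ * (‖x‖ / r) ^ s) →
        (∀ x ∈ Metric.ball (0 : Rd d) (r / 2), ∀ t ∈ timeInterval s (r / 2),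
          u x t ≤ c + a * (1 - θ)) ∨
        ∀ x ∈ Metric.ball (0 : Rd d) (r / 2), ∀ t ∈ timeInterval s (r / 2),
          c - a * (1 - θ) ≤ u x t := by
  obtain ⟨θ, τ, hθ0, hθ1, hτ, H⟩ := growth_lemma hd hs hs1 hlam hLam hb₀
  refine ⟨θ, τ, hθ0, hθ1, hτ, ?_⟩
  intro ρ r R b A a c u hρ hr hρr hrR hb hne hu ha hA hin hout
  set P : Set (Rd d × ℝ) := Metric.ball (0 : Rd d) r ×ˢ pastInterval s r with hP
  have hcover : volume P ≤ volume (P ∩ {p | u p.1 p.2 ≤ c}) +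
      volume (P ∩ {p | -u p.1 p.2 ≤ -c}) := by
    refine (measure_mono fun p hp => ?_).trans (measure_union_le _ _)
    rcases le_total (u p.1 p.2) c with h | h
    · exact Or.inl ⟨hp, h⟩
    · exact Or.inr ⟨hp, neg_le_neg h⟩
  -- One of `{u ≤ c}` and `{u ≥ c}` fills at least half of the past cylinder.
  rcases le_total (volume (P ∩ {p | -u p.1 p.2 ≤ -c})) (volume (P ∩ {p | u p.1 p.2 ≤ c}))
    with h | h
  · left
    refine H ρ r R b A a c u hρ hr hρr hrR hb hne hu.1 ha hA (fun x hx t ht => ?_)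
      (fun x hx t ht => ?_) ?_
    · linarith [(abs_le.1 (hin x hx t ht)).2]
    · linarith [(abs_le.1 (hout x hx t ht)).2]
    · exact hcover.trans (by rw [two_mul]; gcongr)
  · right
    have := H ρ r R b A a (-c) (fun x t => -u x t) hρ hr hρr hrR hb hne hu.2.neg ha hA
      (fun x hx t ht => by linarith [(abs_le.1 (hin x hx t ht)).1])
      (fun x hx t ht => by linarith [(abs_le.1 (hout x hx t ht)).1])
      (hcover.trans (by rw [two_mul]; gcongr))
    intro x hx t ht
    linarith [this x hx t ht]

/-- The amplitude `M (r/R)^α`. -/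
def amplitude (R M α r : ℝ) : ℝ := M * (r / R) ^ α

/-- The oscillation of `u` in the cylinder of radius `r` is controlled by the amplitude, and so is
its growth outside. -/
def OscillationBound (s R M α r : ℝ) (u : Rd d → ℝ → ℝ) : Prop :=
  ∃ c : ℝ, (∀ x ∈ Metric.ball (0 : Rd d) r, ∀ t ∈ timeInterval s r,
      |u x t - c| ≤ amplitude R M α r) ∧
    ∀ x ∉ Metric.ball (0 : Rd d) r, ∀ t ∈ timeInterval s r,
      |u x t - c| ≤ 2 * amplitude R M α (4 * ‖x‖) - amplitude R M α r

theorem amplitude_mono {R M α r r' : ℝ} (hR : 0 < R) (hM : 0 ≤ M) (hα : 0 ≤ α) (hr : 0 ≤ r)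
    (h : r ≤ r') : amplitude R M α r ≤ amplitude R M α r' := by
  unfold amplitude
  gcongr

/-- The decay of the oscillation from one scale to the next one. -/
theorem exists_oscillation_step (hd : 1 ≤ d) {s lam Lam b₀ : ℝ} (hs : 0 < s) (hs1 : s < 1)
    (hlam : 0 < lam) (hLam : 0 < Lam) (hb₀ : 0 ≤ b₀) :
    ∃ α τ : ℝ, 0 < α ∧ α < 2 * s ∧ 0 < τ ∧
      ∀ (ρ r R b A M : ℝ) (u : Rd d → ℝ → ℝ), 0 ≤ ρ → 0 < r → ρ ≤ 2 * r → 2 * r ≤ R →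
        b * r ^ (2 * s - 1) ≤ b₀ → (kernelClass d s lam Lam ρ).Nonempty →
        SolvesExtremalInequalities s lam Lam ρ b A R u → 0 < M → R ^ (2 * s) * A ≤ τ * M →
        OscillationBound s R M α (2 * r) u → OscillationBound s R M α (r / 2) u := by
  obtain ⟨θ, τ, hθ0, hθ1, hτ, H⟩ := oscillation_dichotomy hd hs hs1 hlam hLam hb₀
  -- Three demands on `α`: growth no faster than the power `s`, a loss per step at most the gain `θ
  -- / 2`, and tails small relative to `τ`.
  set α : ℝ := min s (min (θ / 4) (τ * s / (2 * 2 ^ s))) with hα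
  have hα0 : 0 < α := by positivity
  have hαs : α ≤ s := min_le_left _ _
  have hαθ : α ≤ θ / 4 := (min_le_right _ _).trans (min_le_left _ _)
  have hατ : 2 * (α / s) * 2 ^ s ≤ τ := by
    have h1 : α ≤ τ * s / (2 * 2 ^ s) := (min_le_right _ _).trans (min_le_right _ _)
    rw [le_div_iff₀ (by positivity)] at h1
    rw [show 2 * (α / s) * 2 ^ s = α * (2 * 2 ^ s) / s by ring, div_le_iff₀ hs]
    exact h1
  refine ⟨α, τ, hα0, by linarith, hτ, ?_⟩
  intro ρ r R b A M u hρ hr hρr hrR hb hne hu hM hA ⟨c, hin, hout⟩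
  have hR : 0 < R := by linarith
  set a := amplitude R M α (2 * r) with ha
  set a' := amplitude R M α (r / 2) with ha'
  have ha0 : 0 < a := by rw [ha, amplitude]; positivity
  have ha'0 : 0 < a' := by rw [ha', amplitude]; positivity
  have haa : a' ≤ a := amplitude_mono hR hM.le hα0.le (by positivity) (by linarith)
  have hν : 1 - θ / 2 ≤ (1 / 4 : ℝ) ^ α := by
    have hlog : Real.log 4 ≤ 2 := by
      have h2 : Real.log 4 = 2 * Real.log 2 := by
        rw [show (4 : ℝ) = 2 ^ 2 by norm_num, Real.log_pow]; norm_num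
      have := Real.log_two_lt_d9
      linarith
    have h4 : Real.log (1 / 4) = -Real.log 4 := by rw [one_div, Real.log_inv]
    rw [Real.rpow_def_of_pos (by norm_num), h4]
    have h5 := Real.add_one_le_exp (-Real.log 4 * α)
    nlinarith
  have ha'ν : a * (1 - θ / 2) ≤ a' := by
    have h1 : a' = a * (1 / 4) ^ α := by
      rw [ha, ha', amplitude, amplitude, mul_assoc, ← Real.mul_rpow (by positivity) (by norm_num)]
      congr 2
      ring
    rw [h1]
    gcongr
  have hAa : A ≤ τ * a * r ^ (-(2 * s)) := by
    have h1 : (2 * r / R) ^ (2 * s) ≤ (2 * r / R) ^ α :=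
      Real.rpow_le_rpow_of_exponent_ge (by positivity) ((div_le_one hR).2 hrR) (by linarith)
    have h2 : (r / R) ^ (2 * s) ≤ (2 * r / R) ^ (2 * s) := by
      gcongr
      linarith
    have h3 : (r / R) ^ (2 * s) * r ^ (-(2 * s)) * R ^ (2 * s) = 1 := by
      rw [Real.div_rpow hr.le hR.le, Real.rpow_neg hr.le]
      field_simp
    have h4 : A ≤ τ * M * ((r / R) ^ (2 * s) * r ^ (-(2 * s))) := by
      calc A = R ^ (2 * s) * A * ((r / R) ^ (2 * s) * r ^ (-(2 * s))) := by
            linear_combination (-A) * h3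
        _ ≤ _ := by gcongr
    calc A ≤ τ * M * ((r / R) ^ (2 * s) * r ^ (-(2 * s))) := h4
      _ ≤ τ * M * ((2 * r / R) ^ α * r ^ (-(2 * s))) := by
          gcongr
          exact h2.trans h1
      _ = τ * a * r ^ (-(2 * s)) := by rw [ha, amplitude]; ring
  have hout' : ∀ x ∉ Metric.ball (0 : Rd d) (2 * r), ∀ t ∈ timeInterval s (2 * r),
      |u x t - c| ≤ a + a * τ * (‖x‖ / r) ^ s := by
    intro x hx t ht
    refine (hout x hx t ht).trans ?_
    rw [mem_ball_zero_iff, not_lt] at hx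
    set X := 4 * ‖x‖ / (2 * r) with hX
    have hX1 : 1 ≤ X := by rw [hX, one_le_div (by positivity)]; linarith
    have h1 : amplitude R M α (4 * ‖x‖) = a * X ^ α := by
      rw [ha, amplitude, amplitude, mul_assoc, ← Real.mul_rpow (by positivity) (by positivity), hX]
      congr 2
      field_simp
    -- Bernoulli's inequality for the concave power `α / s` of `X ^ s`; the small factor `α / s` is
    -- what makes the tail admissible.
    have h2 : X ^ α ≤ 1 + α / s * X ^ s := by
      have h3 : X ^ α = (1 + (X ^ s - 1)) ^ (α / s) := by
        rw [add_sub_cancel, ← Real.rpow_mul (by linarith), mul_div_cancel₀ _ hs.ne']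
      have h4 : 0 ≤ X ^ s := by positivity
      have h5 := rpow_one_add_le_one_add_mul_self (s := X ^ s - 1) (by linarith)
        (p := α / s) (by positivity) ((div_le_one hs).2 hαs)
      have h6 : 0 < α / s := by positivity
      rw [h3]
      linarith
    have h3 : X ^ s = 2 ^ s * (‖x‖ / r) ^ s := by
      rw [← Real.mul_rpow (by norm_num) (by positivity), hX]
      congr 1
      field_simp
      ring
    have h4 : 2 * (α / s) * X ^ s ≤ τ * (‖x‖ / r) ^ s := by
      rw [h3, ← mul_assoc]
      exact mul_le_mul_of_nonneg_right hατ (by positivity)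
    have h5 : 2 * X ^ α - 1 ≤ 1 + τ * (‖x‖ / r) ^ s := by linarith
    rw [h1]
    calc 2 * (a * X ^ α) - a = a * (2 * X ^ α - 1) := by ring
      _ ≤ a * (1 + τ * (‖x‖ / r) ^ s) := by gcongr
      _ = _ := by ring
  have hsub : ∀ t ∈ timeInterval s (r / 2), t ∈ timeInterval s (2 * r) :=
    timeInterval_mono hs (by positivity) (by linarith)
  have hball : Metric.ball (0 : Rd d) (r / 2) ⊆ Metric.ball 0 (2 * r) :=
    Metric.ball_subset_ball (by linarith)
  -- The outer bound is stable under the step. Outside `B_{2r}` the shift of the center by at most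
  -- `a - a'` just replaces `-a` by `-a'`. Between the two balls, `4 * ‖x‖ ≥ 2 * r` makes the
  -- amplitude at `4 * ‖x‖` at least `a`.
  have conclude : ∀ c' : ℝ, |c - c'| ≤ a - a' →
      (∀ x ∈ Metric.ball (0 : Rd d) (r / 2), ∀ t ∈ timeInterval s (r / 2), |u x t - c'| ≤ a') →
      OscillationBound s R M α (r / 2) u := by
    intro c' hc' hin'
    refine ⟨c', hin', fun x hx t ht => ?_⟩
    have h1 : |u x t - c'| ≤ |u x t - c| + |c - c'| := abs_sub_le _ _ _
    by_cases hx' : x ∈ Metric.ball (0 : Rd d) (2 * r)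
    · have h2 := hin x hx' t (hsub t ht)
      have h3 : a ≤ amplitude R M α (4 * ‖x‖) := by
        rw [mem_ball_zero_iff, not_lt] at hx
        exact amplitude_mono hR hM.le hα0.le (by positivity) (by linarith)
      linarith
    · have h2 := hout x hx' t (hsub t ht)
      linarith
  rcases H ρ r R b A a c u hρ hr hρr hrR hb hne hu ha0 hAa hin hout' with h | h
  -- The values lie between `c - a` and `c + a * (1 - θ)`, an interval of half-length `a * (1 - θ /
  -- 2) ≤ a'`; the new center keeps the lower endpoint `c - a`.
  · refine conclude (c - (a - a')) (by rw [sub_sub_cancel, abs_of_nonneg (by linarith)]) ?_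
    intro x hx t ht
    have h1 := h x hx t ht
    have h2 := (abs_le.1 (hin x (hball hx) t (hsub t ht))).1
    rw [abs_le]
    constructor <;> linarith
  · refine conclude (c + (a - a')) (by
      rw [sub_add_cancel_left, abs_neg, abs_of_nonneg (by linarith)]) ?_
    intro x hx t ht
    have h1 := h x hx t ht
    have h2 := (abs_le.1 (hin x (hball hx) t (hsub t ht))).2
    rw [abs_le]
    constructor <;> linarith

/-! ### Parabolic distance and iteration over scales -/

theorem mem_cylinder_iff {s r : ℝ} (hs : 0 < s) (hr : 0 ≤ r) {x : Rd d} {t : ℝ} (ht : t ≤ 0) :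
    (x, t) ∈ cylinder d s r ↔ parabolicDist s (x, t) (0, 0) < r := by
  have h : -(r ^ (2 * s)) < t ↔ |t| ^ (1 / (2 * s)) < r := by
    rw [neg_lt, ← abs_of_nonpos ht, one_div,
      Real.rpow_inv_lt_iff_of_pos (abs_nonneg t) hr (by positivity)]
  simp [cylinder, timeInterval, parabolicDist, h, ht]

theorem abs_le_supNorm {I : Set ℝ} {u : Rd d → ℝ → ℝ} (hu : IsBoundedOn I u) (x : Rd d) {t : ℝ}
    (ht : t ∈ I) : |u x t| ≤ supNorm I u := by
  obtain ⟨M, hM⟩ := hu.bounded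
  refine le_csSup ⟨M, ?_⟩ ⟨x, t, ht, rfl⟩
  rintro _ ⟨x, t, ht, rfl⟩
  exact hM x t ht

/-- The Hölder estimate for solutions of the extremal inequalities with a drift whose rescaled
coefficients are bounded by `b₀`. -/
theorem exists_partialHolder (hd : 1 ≤ d) {s lam Lam b₀ : ℝ} (hs : 0 < s) (hs1 : s < 1)
    (hlam : 0 < lam) (hLam : 0 < Lam) (hb₀ : 0 ≤ b₀) :
    ∃ α C : ℝ, 0 < α ∧ α < 2 * s ∧ 0 < C ∧
      ∀ ρ R A b : ℝ, 0 ≤ ρ → ρ < R → 0 ≤ A →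
        (∀ r, 0 < r → r ≤ R → b * r ^ (2 * s - 1) ≤ b₀) →
        (kernelClass d s lam Lam ρ).Nonempty →
        ∀ u : Rd d → ℝ → ℝ, IsBoundedOn (timeInterval s R) u →
          SolvesExtremalInequalities s lam Lam ρ b A R u →
          PartialHolderAtZero s ρ R A α C u := by
  obtain ⟨α, τ, hα0, hα2, hτ, H⟩ := exists_oscillation_step hd hs hs1 hlam hLam hb₀
  -- The 2 comes from comparing both values with the center, `4 ^ α` from rounding the distance to a
  -- scale `R / 4 ^ k`, and `1 + 1 / τ` from the size of `M`.
  refine ⟨α, 2 * 4 ^ α * (1 + 1 / τ), hα0, hα2, by positivity, ?_⟩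
  intro ρ R A b hρ hρR hA hb hne u hbd hu x t hxt
  have hR : 0 < R := by linarith
  have h0R : (0 : ℝ) ∈ timeInterval s R := ⟨by simpa using Real.rpow_pos_of_pos hR _, le_rfl⟩
  have hN0 : 0 ≤ supNorm (timeInterval s R) u :=
    (abs_nonneg _).trans (abs_le_supNorm hbd 0 h0R)
  set N := supNorm (timeInterval s R) u with hN
  set B := R ^ (2 * s) * A with hB
  have hB0 : 0 ≤ B := by positivity
  have ht0 : t ≤ 0 := hxt.1.2.2
  have hDR := (mem_cylinder_iff hs hR.le ht0).1 hxt.1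
  have hDρ : ρ ≤ parabolicDist s (x, t) (0, 0) :=
    not_lt.1 fun h => hxt.2 ((mem_cylinder_iff hs hρ ht0).2 h)
  set D := parabolicDist s (x, t) (0, 0) with hD
  have hD0 : 0 ≤ D := hρ.trans hDρ
  -- At distance zero the quotient is `0` by the convention for division by zero, so the origin
  -- needs no exclusion.
  rcases hD0.eq_or_lt with h | hDpos
  · rw [← h, Real.zero_rpow hα0.ne', div_zero, mul_zero]
    positivity
  -- The half-open choice gives `D < R / 4 ^ k ≤ 4 * D`, so the point lies in the cylinder of radius
  -- `R / 4 ^ k`. As `ρ ≤ D`, all scales down to this one are admissible for the iteration.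
  obtain ⟨n, hn1, hn2⟩ := exists_mem_Ioc_zpow (div_pos hR hDpos) (show (1 : ℝ) < 4 by norm_num)
  have hn : 0 ≤ n := by
    by_contra! hneg
    have h1 : (4 : ℝ) ^ (n + 1) ≤ 1 := zpow_le_one_of_nonpos₀ (by norm_num) (by omega)
    have h2 : 1 < R / D := (one_lt_div hDpos).2 hDR
    linarith
  obtain ⟨k, rfl⟩ := Int.eq_ofNat_of_zero_le hn
  rw [zpow_natCast] at hn1
  rw [show ((k : ℤ) + 1) = ((k + 1 : ℕ) : ℤ) by simp, zpow_natCast] at hn2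
  have hDk : D < R / 4 ^ k := by
    rw [lt_div_iff₀ hDpos] at hn1
    rw [lt_div_iff₀ (by positivity)]
    linarith
  have key : ∀ M : ℝ, 0 < M → N ≤ M → B ≤ τ * M →
      R ^ α * (|u x t - u 0 0| / D ^ α) ≤ 2 * 4 ^ α * M := by
    intro M hM hNM hBM
    have hosc : ∀ j : ℕ, ρ ≤ R / 4 ^ j → OscillationBound s R M α (R / 4 ^ j) u := by
      intro j
      induction j with
      | zero =>
        intro _
        have hRR : amplitude R M α R = M := by
          rw [amplitude, div_self hR.ne', Real.one_rpow, mul_one]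
        rw [pow_zero, div_one]
        refine ⟨0, fun y _ τ hτ => ?_, fun y hy τ hτ => ?_⟩
        · rw [sub_zero, hRR]
          exact (abs_le_supNorm hbd y hτ).trans hNM
        · rw [mem_ball_zero_iff, not_lt] at hy
          have h1 := amplitude_mono hR hM.le hα0.le hR.le (show R ≤ 4 * ‖y‖ by linarith)
          have h2 := (abs_le_supNorm hbd y hτ).trans hNM
          rw [hRR] at h1 ⊢
          rw [sub_zero]
          linarith
      | succ j ih =>
        intro hj
        have hpos : 0 < R / 4 ^ j := by positivity
        have hle : R / 4 ^ j ≤ R := div_le_self hR.le (one_le_pow₀ (by norm_num))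
        have hjj : R / 4 ^ (j + 1) = R / 4 ^ j / 2 / 2 := by rw [pow_succ]; field_simp; norm_num
        have hρj : ρ ≤ R / 4 ^ j := by rw [hjj] at hj; linarith
        have h2 : 2 * (R / 4 ^ j / 2) = R / 4 ^ j := by ring
        rw [hjj]
        refine H ρ (R / 4 ^ j / 2) R b A M u hρ (by positivity) (by rw [h2]; exact hρj)
          (by rw [h2]; exact hle) (hb _ (by positivity) (by linarith)) hne hu hM hBM ?_
        rw [h2]
        exact ih hρj
    obtain ⟨c, hc, -⟩ := hosc k (hDρ.trans hDk.le)
    have hpos : 0 < R / 4 ^ k := by positivity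
    have hmem := (mem_cylinder_iff (x := x) hs hpos.le ht0).2 hDk
    have h1 := hc x hmem.1 t hmem.2
    have h2 := hc 0 (Metric.mem_ball_self hpos) 0
      ⟨by simpa using Real.rpow_pos_of_pos hpos _, le_rfl⟩
    have h3 : |u x t - u 0 0| ≤ 2 * amplitude R M α (R / 4 ^ k) := by
      calc |u x t - u 0 0| ≤ |u x t - c| + |c - u 0 0| := abs_sub_le _ _ _
        _ ≤ _ := by rw [abs_sub_comm c]; linarith
    have h4 : R ^ α * (amplitude R M α (R / 4 ^ k) / D ^ α) = M * (R / D / 4 ^ k) ^ α := by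
      rw [amplitude, Real.div_rpow hpos.le hR.le, div_right_comm R D,
        Real.div_rpow hpos.le hD0]
      field_simp
    have h5 : R / D / 4 ^ k ≤ 4 := by
      rw [div_le_iff₀ (by positivity)]
      rw [pow_succ] at hn2
      linarith
    calc R ^ α * (|u x t - u 0 0| / D ^ α)
        ≤ R ^ α * (2 * amplitude R M α (R / 4 ^ k) / D ^ α) := by gcongr
      _ = 2 * (M * (R / D / 4 ^ k) ^ α) := by rw [← h4]; ring
      _ ≤ 2 * (M * 4 ^ α) := by gcongr
      _ = 2 * 4 ^ α * M := by ring
  refine le_of_forall_pos_le_add fun e he => ?_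
  have h4 : 0 < 2 * (4 : ℝ) ^ α := by positivity
  -- The decay step needs a strictly positive amplitude; the extra term ensures this when `N` and
  -- `B` vanish and contributes exactly `e`.
  have hM := key (N + B / τ + e / (2 * 4 ^ α)) (by positivity)
    (by have : 0 ≤ B / τ := by positivity
        have : 0 < e / (2 * 4 ^ α) := by positivity
        linarith)
    (by have h1 : τ * (B / τ) = B := mul_div_cancel₀ B hτ.ne'
        have h2 : 0 ≤ τ * N := by positivity
        have h3 : 0 < τ * (e / (2 * 4 ^ α)) := by positivity
        rw [mul_add, mul_add]
        linarith)
  refine hM.trans ?_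
  have h6 : 2 * (4 : ℝ) ^ α * (e / (2 * 4 ^ α)) = e := mul_div_cancel₀ e h4.ne'
  have h7 : N + B / τ ≤ (1 + 1 / τ) * (N + B) := by
    have h8 : 0 ≤ 1 / τ * N := by positivity
    have h9 : B / τ = 1 / τ * B := by ring
    rw [h9]
    linarith
  calc 2 * 4 ^ α * (N + B / τ + e / (2 * 4 ^ α)) = 2 * 4 ^ α * (N + B / τ) + e := by
        rw [mul_add (2 * (4 : ℝ) ^ α), h6]
    _ ≤ 2 * 4 ^ α * ((1 + 1 / τ) * (N + B)) + e := by gcongr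
    _ = _ := by ring

end NonlocalParabolic

end

/-! ### The cases with and without drift -/

open NonlocalParabolic

theorem mainTheorem1 (d : ℕ) (hd : 1 ≤ d) (s lam Lam : ℝ) (hs : 0 < s) (hs1 : s < 1)
    (hlam : 0 < lam) (hLam : 0 < Lam) :
    (1 / 2 ≤ s → ∀ R₀ : ℝ, 0 < R₀ →
      ∃ α C : ℝ, 0 < α ∧ α < 2 * s ∧ 0 < C ∧
        ∀ ρ R A : ℝ, 0 ≤ ρ → ρ < R → R ≤ R₀ → 0 ≤ A →
          (kernelClass d s lam Lam ρ).Nonempty →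
          ∀ u : Rd d → ℝ → ℝ, IsBoundedOn (timeInterval s R) u →
            SolvesExtremalInequalities s lam Lam ρ Lam A R u →
            PartialHolderAtZero s ρ R A α C u) ∧
    (∃ α C : ℝ, 0 < α ∧ α < 2 * s ∧ 0 < C ∧
        ∀ ρ R A : ℝ, 0 ≤ ρ → ρ < R → 0 ≤ A →
          (kernelClass d s lam Lam ρ).Nonempty →
          ∀ u : Rd d → ℝ → ℝ, IsBoundedOn (timeInterval s R) u →
            SolvesExtremalInequalities s lam Lam ρ 0 A R u →
            PartialHolderAtZero s ρ R A α C u) := by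
  constructor
  · intro hs2 R₀ hR₀
    -- For `s ≥ 1/2` the exponent `2 * s - 1` is nonnegative, so the rescaled drift is largest at
    -- the top radius. This is the only place where `R₀` enters the constants.
    obtain ⟨α, C, hα0, hα, hC, H⟩ := exists_partialHolder hd hs hs1 hlam hLam
      (b₀ := Lam * R₀ ^ (2 * s - 1)) (by positivity)
    refine ⟨α, C, hα0, hα, hC, fun ρ R A hρ hρR hRR hA hne u hbd hu => ?_⟩
    refine H ρ R A Lam hρ hρR hA (fun r hr hrR => ?_) hne u hbd hu
    gcongr
    · linarith
    · linarith
  · obtain ⟨α, C, hα0, hα, hC, H⟩ := exists_partialHolder hd hs hs1 hlam hLam (le_refl (0 : ℝ))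
    exact ⟨α, C, hα0, hα, hC, fun ρ R A hρ hρR hA hne u hbd hu =>
      H ρ R A 0 hρ hρR hA (fun r _ _ => by rw [zero_mul]) hne u hbd hu⟩
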